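/- **Setting.** All rings are commutative and unital, and $\mathsf{CRING}$ is the category of rings. Let $\mathsf{T}(R)=\mathrm{Sym}_R(\Omega(R))$ be the symmetric algebra of the module of Kähler differentials of $R$ over $\mathbb Z$; it is generated as a ring by the elements $a$ and $\mathsf d(a)$, $a\in R$. A ring map $f$ is sent to the map $a\mapsto f(a)$, $\mathsf d(a)\mapsto \mathsf d(f(a))$. The opposite category $\mathsf{CRING}^{op}$ is a tangent category with negatives whose structure maps are, written as ring maps (with $\pi_1,\pi_2:\mathsf T(R)\to \mathsf T(R)\otimes_R\mathsf T(R)$ the coprojections, and $\mathsf d'$ the differential of the outer $\mathsf T$ in $\mathsf T^2(R)$): $p(a)=a$; $+(a)=a$, $+(\mathsf d(a))=\pi_1\mathsf d(a)+\pi_2\mathsf d(a)$; $0(a)=a$, $0(\mathsf d(a))=0$; $-(a)=a$, $-(\mathsf d(a))=-\mathsf d(a)$; $\ell(a)=a$, $\ell(\mathsf d(a))=0$, $\ell(\mathsf d'(a))=0$, $\ell(\mathsf d'\mathsf d(a))=\mathsf d(a)$; $c(a)=a$, $c(\mathsf d(a))=\mathsf d'(a)$, $c(\mathsf d'(a))=\mathsf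 d(a)$, $c(\mathsf d'\mathsf d(a))=\mathsf d'\mathsf d(a)$. **Differential bundles.** A differential bundle in a tangent category $(\mathbb X,\mathbb T)$ consists of a base $A$, a total object $E$ and maps $q:E\to A$, $\sigma:E_2\to E$, $z:A\to E$, $\lambda:E\to \mathsf T(E)$ such that: all fibre powers $E_n$ of $q$ over $A$ exist and are preserved by every $\mathsf T^m$; $(q,\sigma,z)$ is a commutative monoid over $A$; $\lambda$ is a morphism of additive bundles over $0_A:A\to \mathsf T(A)$ into $(\mathsf T(q),\mathsf T(\sigma),\mathsf T(z))$ and over $z:A\to E$ into $(p_E,+_E,0_E)$; $\mathsf T(\lambda)\circ\lambda=\ell_E\circ\lambda$; and, with $\mu=\mathsf T(\sigma)\circ\langle \lambda\circ\pi_1,\,0_E\circ\pi_2\rangle:E_2\to \mathsf T(E)$, the square $\mathsf T(q)\circ\mu = 0_A\circ q\circ\pi_1$ is a pullback (of $\mathsf T(q)$ along $0_A$) preserved by every $\mathsf T^n$. It has negatives if there is $\iota:E\to E$ over $A$ which is a fibrewise additive inverse for $\sigma$. A morphism from $(A,E,q,\sigma,z,\lambda)$ to $(A',E',q',\sigma',z',\lambda')$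 is a pair $(f:E\to E',\ g:A\to A')$ with $q'\circ f=g\circ q$ and $\lambda'\circ f=\mathsf T(f)\circ\lambda$. Let $\mathsf{DBun}[(\mathbb X,\mathbb T)]$ be the category of all differential bundles, with varying base. **Modules.** Let $\mathsf{MOD}$ be the category of pairs $(R,M)$ of a ring $R$ and an $R$-module $M$; a map $(R,M)\to(S,N)$ is a pair $(g,f)$ of a ring map $g:R\to S$ and an additive map $f:M\to N$ with $f(am)=g(a)f(m)$. **Theorem.** There is a functor $\mathsf{MOD}^{op}\to\mathsf{DBun}[(\mathsf{CRING}^{op},\mathbb T)]$ sending $(R,M)$ to a differential bundle with negatives over $R$ with total object $\mathrm{Sym}_R(M)$ and structure maps, written as ring maps, $q(a)=a$; $\sigma(a)=a$, $\sigma(m)=\pi_1(m)+\pi_2(m)$; $z(a)=a$, $z(m)=0$; $\lambda(a)=a$, $\lambda(m)=0$, $\lambda(\mathsf d(a))=0$, $\lambda(\mathsf d(m))=m$; $\iota(a)=a$, $\iota(m)=-m$ (for $a\in R$, $m\in M$), and sending a map $(g,f)$ to the pair consisting of the induced ring map $\mathrm{Sym}_R(M)\to\mathrm{Sym}_S(N)$,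 $a\mapsto g(a)$, $m\mapsto f(m)$, and of $g$. This functor is an equivalence of categories $$\mathsf{MOD}^{op}\simeq\mathsf{DBun}[(\mathsf{CRING}^{op},\mathbb T)],$$ both when the objects on the right are differential bundles with negatives and when they are differential bundles without a chosen negative. -/

import Mathlib

open CategoryTheory CategoryTheory.Limits Opposite

/-! ### Fibre powers, additive bundles -/

section FibrePowers

universe v u

variable {C : Type u} [Category.{v} C]

/-- The iterates `F ^ n` of an endofunctor. -/
def iterFunctor (F : C ⥤ C) : ℕ → C ⥤ C
  | 0 => 𝟭 C
  | n + 1 => iterFunctor F n ⋙ F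

/-- For every `n`, the pullback of `n` copies of `q : E ⟶ A` exists. -/
class HasFibrePowers {E A : C} (q : E ⟶ A) : Prop where
  hasWidePullback (n : ℕ) : HasWidePullback A (fun _ : Fin n => E) (fun _ => q)

attribute [instance] HasFibrePowers.hasWidePullback

/-- For all `m` and `n`, the functor `F ^ m` preserves the pullback of `n` copies of `q`. -/
class PreservesFibrePowers (F : C ⥤ C) {E A : C} (q : E ⟶ A) : Prop where
  preservesLimit (m n : ℕ) : PreservesLimit
    (WidePullbackShape.wideCospan A (fun _ : Fin n => E) (fun _ => q)) (iterFunctor F m)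

instance PreservesFibrePowers.one (F : C ⥤ C) {E A : C} (q : E ⟶ A)
    [h : PreservesFibrePowers F q] (n : ℕ) :
    PreservesLimit (WidePullbackShape.wideCospan A (fun _ : Fin n => E) (fun _ => q)) F :=
  h.preservesLimit 1 n

/-- `fibrePow q n` is the pullback `E_n` of `n` copies of `q : E ⟶ A`. -/
noncomputable abbrev fibrePow {E A : C} (q : E ⟶ A) [HasFibrePowers q] (n : ℕ) : C :=
  widePullback A (fun _ : Fin n => E) (fun _ => q)

namespace fibrePow

variable {E A : C} (q : E ⟶ A) [HasFibrePowers q]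

/-- The projections `π_j : E_n ⟶ E`. -/
noncomputable abbrev proj {n : ℕ} (j : Fin n) : fibrePow q n ⟶ E :=
  WidePullback.π (fun _ : Fin n => q) j

theorem proj_comp {n : ℕ} (i j : Fin n) : proj q i ≫ q = proj q j ≫ q := by
  rw [WidePullback.π_arrow (fun _ : Fin n => q) i, WidePullback.π_arrow (fun _ : Fin n => q) j]

/-- The pairing `⟨f, g⟩ : X ⟶ E_2`. -/
noncomputable def pair {X : C} (f g : X ⟶ E) (h : f ≫ q = g ≫ q) : X ⟶ fibrePow q 2 :=
  WidePullback.lift (f ≫ q) ![f, g] (by intro j; fin_cases j <;> simp [h])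

@[simp]
theorem pair_zero {X : C} (f g : X ⟶ E) (h : f ≫ q = g ≫ q) : pair q f g h ≫ proj q 0 = f :=
  WidePullback.lift_π _ _ _ _ _

@[simp]
theorem pair_one {X : C} (f g : X ⟶ E) (h : f ≫ q = g ≫ q) : pair q f g h ≫ proj q 1 = g :=
  WidePullback.lift_π _ _ _ _ _

theorem pair_comp {X : C} (f g : X ⟶ E) (h : f ≫ q = g ≫ q) : pair q f g h ≫ proj q 0 ≫ q = f ≫ q := by
  rw [← Category.assoc, pair_zero]

theorem hom_ext {X : C} {f g : X ⟶ fibrePow q 2} (h₀ : f ≫ proj q 0 = g ≫ proj q 0)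
    (h₁ : f ≫ proj q 1 = g ≫ proj q 1) : f = g := by
  apply WidePullback.hom_ext
  · intro j
    fin_cases j
    · exact h₀
    · exact h₁
  · rw [← WidePullback.π_arrow (fun _ : Fin 2 => q) 0]
    simp only [← Category.assoc]
    exact congrArg (· ≫ q) h₀

variable (F : C ⥤ C) [PreservesFibrePowers F q]

/-- The pairing `⟨f, g⟩ : X ⟶ F(E_2)`, where `F(E_2)` is the pullback of two copies of `F(q)`
because `F` preserves fibre powers of `q`. -/
noncomputable def mapPair {X : C} (f g : X ⟶ F.obj E) (h : f ≫ F.map q = g ≫ F.map q) :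
    X ⟶ F.obj (fibrePow q 2) :=
  (isLimitOfPreserves F (limit.isLimit
    (WidePullbackShape.wideCospan A (fun _ : Fin 2 => E) (fun _ => q)))).lift
    (WidePullbackShape.mkCone (f ≫ F.map q) (fun j => (![f, g] : Fin 2 → (X ⟶ F.obj E)) j)
      (by
        intro j
        fin_cases j
        · rfl
        · exact h.symm))

@[simp]
theorem mapPair_zero {X : C} (f g : X ⟶ F.obj E) (h : f ≫ F.map q = g ≫ F.map q) :
    mapPair q F f g h ≫ F.map (proj q 0) = f :=
  (isLimitOfPreserves F (limit.isLimit
    (WidePullbackShape.wideCospan A (fun _ : Fin 2 => E) (fun _ => q)))).fac _ (some 0)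

@[simp]
theorem mapPair_one {X : C} (f g : X ⟶ F.obj E) (h : f ≫ F.map q = g ≫ F.map q) :
    mapPair q F f g h ≫ F.map (proj q 1) = g :=
  (isLimitOfPreserves F (limit.isLimit
    (WidePullbackShape.wideCospan A (fun _ : Fin 2 => E) (fun _ => q)))).fac _ (some 1)

end fibrePow

open fibrePow

/-- `(q, σ, z)` is an additive bundle over `A`: a commutative monoid in the slice category
over `A`. -/
structure IsAdditiveBundle {E A : C} (q : E ⟶ A) [HasFibrePowers q] (σ : fibrePow q 2 ⟶ E)
    (z : A ⟶ E) : Prop where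
  add_proj (j : Fin 2) : σ ≫ q = proj q j ≫ q
  zero_proj : z ≫ q = 𝟙 A
  add_assoc :
    pair q (pair q (proj q (0 : Fin 3)) (proj q 1) (proj_comp q 0 1) ≫ σ) (proj q 2)
        (by rw [Category.assoc, add_proj 0, pair_comp]; exact proj_comp q 0 2) ≫ σ =
      pair q (proj q (0 : Fin 3)) (pair q (proj q 1) (proj q 2) (proj_comp q 1 2) ≫ σ)
        (by rw [Category.assoc, add_proj 0, pair_comp]; exact proj_comp q 0 1) ≫ σ
  zero_add : pair q (q ≫ z) (𝟙 E) (by simp [zero_proj]) ≫ σ = 𝟙 E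
  add_zero : pair q (𝟙 E) (q ≫ z) (by simp [zero_proj]) ≫ σ = 𝟙 E
  add_comm : pair q (proj q 1) (proj q 0) (proj_comp q 1 0) ≫ σ = σ

/-- `ι` is a negation for the additive bundle `(q, σ, z)`, making it an abelian group bundle. -/
structure IsNegation {E A : C} (q : E ⟶ A) [HasFibrePowers q] (σ : fibrePow q 2 ⟶ E)
    (z : A ⟶ E) (ι : E ⟶ E) : Prop where
  neg_proj : ι ≫ q = q
  add_neg : pair q (𝟙 E) ι (by simp [neg_proj]) ≫ σ = q ≫ z
  neg_add : pair q ι (𝟙 E) (by simp [neg_proj]) ≫ σ = q ≫ z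

/-- A commutative square is sent to a pullback square by all `F ^ n`, `n ≥ 0`
(for `n = 0`: the square itself is a pullback). -/
def IsPreservedPullback (F : C ⥤ C) {P X Y Z : C} (fst : P ⟶ X) (snd : P ⟶ Y) (f : X ⟶ Z)
    (g : Y ⟶ Z) : Prop :=
  ∀ n : ℕ, IsPullback ((iterFunctor F n).map fst) ((iterFunctor F n).map snd)
    ((iterFunctor F n).map f) ((iterFunctor F n).map g)

end FibrePowers

/-! ### Tangent categories -/

section Tangent

universe v u

open fibrePow

/-- A tangent structure on a category `C`. -/
structure TangentStructure (C : Type u) [Category.{v} C] where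
  /-- the tangent bundle functor -/
  T : C ⥤ C
  /-- the projection -/
  p : T ⟶ 𝟭 C
  hasFibrePowers (A : C) : HasFibrePowers (p.app A)
  preservesFibrePowers (A : C) : PreservesFibrePowers T (p.app A)
  /-- the sum -/
  add (A : C) : fibrePow (p.app A) 2 ⟶ T.obj A
  add_naturality {A B : C} (f : A ⟶ B) :
    add A ≫ T.map f =
      pair (p.app B) (proj (p.app A) 0 ≫ T.map f) (proj (p.app A) 1 ≫ T.map f)
        (by
          rw [Category.assoc, Category.assoc, p.naturality, ← Category.assoc, ← Category.assoc]
          exact congrArg (· ≫ (𝟭 C).map f) (proj_comp (p.app A) 0 1)) ≫ add B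
  /-- the zero -/
  zero : 𝟭 C ⟶ T
  /-- the vertical lift -/
  lift : T ⟶ T ⋙ T
  /-- the canonical flip -/
  flip : T ⋙ T ⟶ T ⋙ T
  isAdditiveBundle (A : C) : IsAdditiveBundle (p.app A) (add A) (zero.app A)
  lift_proj (A : C) : lift.app A ≫ T.map (p.app A) = p.app A ≫ zero.app A
  lift_add (A : C) :
    mapPair (p.app A) T (proj (p.app A) 0 ≫ lift.app A) (proj (p.app A) 1 ≫ lift.app A)
        (by
          rw [Category.assoc, Category.assoc, lift_proj, ← Category.assoc, ← Category.assoc]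
          exact congrArg (· ≫ zero.app A) (proj_comp (p.app A) 0 1)) ≫ T.map (add A) =
      add A ≫ lift.app A
  lift_zero (A : C) : zero.app A ≫ lift.app A = zero.app A ≫ T.map (zero.app A)
  flip_proj (A : C) : flip.app A ≫ p.app (T.obj A) = T.map (p.app A)
  flip_add (A : C) :
    pair (p.app (T.obj A)) (T.map (proj (p.app A) 0) ≫ flip.app A)
        (T.map (proj (p.app A) 1) ≫ flip.app A)
        (by
          rw [Category.assoc, Category.assoc, flip_proj, ← T.map_comp, ← T.map_comp]
          exact congrArg T.map (proj_comp (p.app A) 0 1)) ≫ add (T.obj A) =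
      T.map (add A) ≫ flip.app A
  flip_zero (A : C) : T.map (zero.app A) ≫ flip.app A = zero.app (T.obj A)
  flip_flip (A : C) : flip.app A ≫ flip.app A = 𝟙 (T.obj (T.obj A))
  flip_yangBaxter (A : C) :
    T.map (flip.app A) ≫ flip.app (T.obj A) ≫ T.map (flip.app A) =
      flip.app (T.obj A) ≫ T.map (flip.app A) ≫ flip.app (T.obj A)
  lift_lift (A : C) : lift.app A ≫ lift.app (T.obj A) = lift.app A ≫ T.map (lift.app A)
  lift_flip (A : C) : lift.app A ≫ flip.app A = lift.app A
  lift_flip_flip (A : C) :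
    lift.app (T.obj A) ≫ T.map (flip.app A) ≫ flip.app (T.obj A) =
      flip.app A ≫ T.map (lift.app A)
  lift_universal (A : C) (j : Fin 2) :
    IsPreservedPullback T
      (mapPair (p.app A) T (proj (p.app A) 0 ≫ lift.app A)
          (proj (p.app A) 1 ≫ zero.app (T.obj A))
          (by
            have h := zero.naturality (p.app A)
            have h' := congrArg (· ≫ zero.app A) (proj_comp (p.app A) (0 : Fin 2) 1)
            simp only [Functor.id_map, Functor.id_obj, Category.assoc] at h h'
            rw [Category.assoc, Category.assoc, ← h, lift_proj]
            exact h') ≫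
        T.map (add A))
      (proj (p.app A) j ≫ p.app A) (T.map (p.app A)) (zero.app A)

attribute [instance] TangentStructure.hasFibrePowers TangentStructure.preservesFibrePowers

/-- A tangent structure with negatives on `C`. -/
structure RosickyTangentStructure (C : Type u) [Category.{v} C] extends TangentStructure C where
  /-- the negative -/
  neg : T ⟶ T
  isNegation (A : C) : IsNegation (p.app A) (add A) (zero.app A) (neg.app A)

/-! ### Differential bundles -/

variable {C : Type u} [Category.{v} C]

/-- A differential bundle in the tangent category `(C, 𝕋)`. -/
structure DifferentialBundle (𝕋 : TangentStructure C) where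
  /-- the base object -/
  base : C
  /-- the total object -/
  total : C
  /-- the projection -/
  q : total ⟶ base
  hasFibrePowers : HasFibrePowers q
  preservesFibrePowers : PreservesFibrePowers 𝕋.T q
  /-- the sum -/
  σ : fibrePow q 2 ⟶ total
  /-- the zero -/
  z : base ⟶ total
  /-- the lift -/
  lam : total ⟶ 𝕋.T.obj total
  isAdditiveBundle : IsAdditiveBundle q σ z
  lam_map_proj : lam ≫ 𝕋.T.map q = q ≫ 𝕋.zero.app base
  lam_map_add :
    mapPair q 𝕋.T (proj q 0 ≫ lam) (proj q 1 ≫ lam)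
        (by
          rw [Category.assoc, Category.assoc, lam_map_proj, ← Category.assoc, ← Category.assoc]
          exact congrArg (· ≫ 𝕋.zero.app base) (proj_comp q 0 1)) ≫ 𝕋.T.map σ =
      σ ≫ lam
  lam_map_zero : z ≫ lam = 𝕋.zero.app base ≫ 𝕋.T.map z
  lam_proj : lam ≫ 𝕋.p.app total = q ≫ z
  lam_add :
    pair (𝕋.p.app total) (proj q 0 ≫ lam) (proj q 1 ≫ lam)
        (by
          rw [Category.assoc, Category.assoc, lam_proj, ← Category.assoc, ← Category.assoc]
          exact congrArg (· ≫ z) (proj_comp q 0 1)) ≫ 𝕋.add total =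
      σ ≫ lam
  lam_zero : z ≫ lam = z ≫ 𝕋.zero.app total
  lam_lam : lam ≫ 𝕋.T.map lam = lam ≫ 𝕋.lift.app total
  lam_universal (j : Fin 2) :
    IsPreservedPullback 𝕋.T
      (mapPair q 𝕋.T (proj q 0 ≫ lam) (proj q 1 ≫ 𝕋.zero.app total)
          (by
            have h := 𝕋.zero.naturality q
            have h' := congrArg (· ≫ 𝕋.zero.app base) (proj_comp q (0 : Fin 2) 1)
            simp only [Functor.id_map, Functor.id_obj, Category.assoc] at h h'
            rw [Category.assoc, Category.assoc, ← h, lam_map_proj]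
            exact h') ≫
        𝕋.T.map σ)
      (proj q j ≫ q) (𝕋.T.map q) (𝕋.zero.app base)

attribute [instance] DifferentialBundle.hasFibrePowers DifferentialBundle.preservesFibrePowers

namespace DifferentialBundle

variable {𝕋 : TangentStructure C}

/-- A morphism of differential bundles, with varying base. -/
@[ext]
structure Hom (𝓔 𝓔' : DifferentialBundle 𝕋) where
  /-- the map between the total objects -/
  f : 𝓔.total ⟶ 𝓔'.total
  /-- the map between the base objects -/
  g : 𝓔.base ⟶ 𝓔'.base
  comm_q : 𝓔.q ≫ g = f ≫ 𝓔'.q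
  comm_lam : f ≫ 𝓔'.lam = 𝓔.lam ≫ 𝕋.T.map f

/-- The category of all differential bundles in `(C, 𝕋)`. -/
instance : Category (DifferentialBundle 𝕋) where
  Hom := Hom
  id 𝓔 := ⟨𝟙 _, 𝟙 _, by simp, by simp⟩
  comp F G := ⟨F.f ≫ G.f, F.g ≫ G.g,
    by rw [← Category.assoc, F.comm_q, Category.assoc, G.comm_q, Category.assoc],
    by rw [Category.assoc, G.comm_lam, ← Category.assoc, F.comm_lam, Category.assoc,
      Functor.map_comp]⟩

variable (𝕋)

/-- The functor sending a differential bundle to its base object. -/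
@[simps]
def baseFunctor : DifferentialBundle 𝕋 ⥤ C where
  obj 𝓔 := 𝓔.base
  map F := F.g

/-- The functor sending a differential bundle to its total object. -/
@[simps]
def totalFunctor : DifferentialBundle 𝕋 ⥤ C where
  obj 𝓔 := 𝓔.total
  map F := F.f

end DifferentialBundle

/-- A differential bundle with negatives in the tangent category `(C, 𝕋)`. -/
structure DifferentialBundleWithNeg (𝕋 : TangentStructure C) extends DifferentialBundle 𝕋 where
  /-- the negative -/
  neg : total ⟶ total
  isNegation : IsNegation q σ z neg

/-- The category of differential bundles with negatives: its morphisms are the differential bundle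
morphisms between the underlying differential bundles. -/
instance (𝕋 : TangentStructure C) : Category (DifferentialBundleWithNeg 𝕋) :=
  inferInstanceAs (Category (InducedCategory (DifferentialBundle 𝕋)
    DifferentialBundleWithNeg.toDifferentialBundle))

/-- The functor forgetting the negative. -/
def DifferentialBundleWithNeg.forgetNeg (𝕋 : TangentStructure C) :
    DifferentialBundleWithNeg 𝕋 ⥤ DifferentialBundle 𝕋 :=
  inducedFunctor DifferentialBundleWithNeg.toDifferentialBundle

end Tangent

/-! ### The tangent category of affine schemes -/

section TangentAlgebra

universe u

/-- The tangent algebra `T(R) = Sym_R(Ω(R))` of a commutative ring. -/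
def TangentAlgebra (R : Type u) [CommRing R] : Type u :=
  SymmetricAlgebra R (KaehlerDifferential ℤ R)

namespace TangentAlgebra

noncomputable instance (R : Type u) [CommRing R] : CommRing (TangentAlgebra R) :=
  inferInstanceAs (CommRing (SymmetricAlgebra R (KaehlerDifferential ℤ R)))

variable {R : Type u} [CommRing R] {S : Type u} [CommRing S]

/-- The canonical inclusion `R → T(R)`. -/
noncomputable def incl (R : Type u) [CommRing R] : R →+* TangentAlgebra R :=
  algebraMap R (SymmetricAlgebra R (KaehlerDifferential ℤ R))

/-- The generators `d(a)` of `T(R)`. -/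
noncomputable def d (R : Type u) [CommRing R] : R →+ TangentAlgebra R :=
  AddMonoidHom.comp
    (SymmetricAlgebra.ι R (KaehlerDifferential ℤ R)).toAddMonoidHom
    (KaehlerDifferential.D ℤ R).toLinearMap.toAddMonoidHom

theorem d_apply (a : R) :
    d R a = SymmetricAlgebra.ι R (KaehlerDifferential ℤ R) (KaehlerDifferential.D ℤ R a) := rfl

theorem d_mul (a b : R) : d R (a * b) = incl R a * d R b + incl R b * d R a := by
  rw [d_apply, d_apply, d_apply, Derivation.leibniz, map_add, map_smul, map_smul,
    Algebra.smul_def, Algebra.smul_def]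
  rfl

/-- A ring morphism `f : R → S` and a derivation `D : R → S` along `f` induce a ring morphism
`T(R) → S` with `a ↦ f(a)` and `d(a) ↦ D(a)`. -/
noncomputable def lift (f : R →+* S) (D : R →+ S)
    (h : ∀ a b, D (a * b) = f a * D b + f b * D a) : TangentAlgebra R →+* S :=
  letI := f.toAlgebra
  (SymmetricAlgebra.lift (Derivation.liftKaehlerDifferential
    (Derivation.mk' (R := ℤ) (A := R) (M := S) D.toIntLinearMap h))).toRingHom

@[simp]
theorem lift_incl (f : R →+* S) (D : R →+ S) (h) (a : R) : lift f D h (incl R a) = f a := by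
  let _ := f.toAlgebra
  exact AlgHom.commutes (SymmetricAlgebra.lift (Derivation.liftKaehlerDifferential
    (Derivation.mk' (R := ℤ) (A := R) (M := S) D.toIntLinearMap h))) a

@[simp]
theorem lift_d (f : R →+* S) (D : R →+ S) (h) (a : R) : lift f D h (d R a) = D a := by
  let _ := f.toAlgebra
  exact (SymmetricAlgebra.lift_ι_apply (Derivation.liftKaehlerDifferential
    (Derivation.mk' (R := ℤ) (A := R) (M := S) D.toIntLinearMap h)) _).trans
    (Derivation.liftKaehlerDifferential_comp_D _ a)

theorem induction {motive : TangentAlgebra R → Prop} (hincl : ∀ a, motive (incl R a))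
    (hd : ∀ a, motive (d R a)) (hmul : ∀ x y, motive x → motive y → motive (x * y))
    (hadd : ∀ x y, motive x → motive y → motive (x + y)) (x : TangentAlgebra R) : motive x := by
  refine SymmetricAlgebra.induction (R := R) (M := KaehlerDifferential ℤ R) (motive := motive)
    hincl ?_ hmul hadd x
  intro w
  have hw : w ∈ Submodule.span R (Set.range (KaehlerDifferential.D ℤ R)) := by
    rw [KaehlerDifferential.span_range_derivation]; trivial
  induction hw using Submodule.span_induction with
  | mem w hw => obtain ⟨a, rfl⟩ := hw; exact hd a
  | zero =>
    have h := hincl 0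
    rw [map_zero] at h
    rw [map_zero]
    exact h
  | add w w' _ _ h h' => rw [map_add]; exact hadd _ _ h h'
  | smul a w _ h => rw [map_smul, Algebra.smul_def]; exact hmul _ _ (hincl a) h

theorem hom_ext {f g : TangentAlgebra R →+* S} (hincl : ∀ a, f (incl R a) = g (incl R a))
    (hd : ∀ a, f (d R a) = g (d R a)) : f = g := by
  ext x
  induction x using induction with
  | hincl a => exact hincl a
  | hd a => exact hd a
  | hmul x y hx hy => rw [map_mul, map_mul, hx, hy]
  | hadd x y hx hy => rw [map_add, map_add, hx, hy]

/-- The ring morphism `T(f) : T(R) → T(S)`, with `a ↦ f(a)` and `d(a) ↦ d(f(a))`. -/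
noncomputable def map (f : R →+* S) : TangentAlgebra R →+* TangentAlgebra S :=
  lift ((incl S).comp f) ((d S).comp f.toAddMonoidHom) (fun a b => by simp [d_mul])

@[simp]
theorem map_incl (f : R →+* S) (a : R) : map f (incl R a) = incl S (f a) := by simp [map]

@[simp]
theorem map_d (f : R →+* S) (a : R) : map f (d R a) = d S (f a) := by simp [map]

/-- The ring morphism `0_R : T(R) → R`, with `a ↦ a` and `d(a) ↦ 0`. -/
noncomputable def zeroHom (R : Type u) [CommRing R] : TangentAlgebra R →+* R :=
  lift (RingHom.id R) 0 (by simp)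

@[simp]
theorem zeroHom_incl (a : R) : zeroHom R (incl R a) = a := by simp [zeroHom]

@[simp]
theorem zeroHom_d (a : R) : zeroHom R (d R a) = 0 := by simp [zeroHom]

/-- The ring morphism `-_R : T(R) → T(R)`, with `a ↦ a` and `d(a) ↦ -d(a)`. -/
noncomputable def negHom (R : Type u) [CommRing R] : TangentAlgebra R →+* TangentAlgebra R :=
  lift (incl R) (-d R) (by intro a b; simp [d_mul]; ring)

@[simp]
theorem negHom_incl (a : R) : negHom R (incl R a) = incl R a := by simp [negHom]

@[simp]
theorem negHom_d (a : R) : negHom R (d R a) = -d R a := by simp [negHom]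

/-- The additive map `a ↦ f(a) + D(a)ε` to the dual numbers of `S`. -/
def dualAddHom (f D : R →+ S) : R →+ DualNumber S where
  toFun a := TrivSqZeroExt.inl (f a) + TrivSqZeroExt.inr (D a)
  map_zero' := by ext <;> simp
  map_add' a b := by ext <;> simp

@[simp]
theorem dualAddHom_fst (f D : R →+ S) (a : R) : TrivSqZeroExt.fst (dualAddHom f D a) = f a := by
  simp [dualAddHom]

@[simp]
theorem dualAddHom_snd (f D : R →+ S) (a : R) : TrivSqZeroExt.snd (dualAddHom f D a) = D a := by
  simp [dualAddHom]

/-- A ring morphism `f : R → S` and a derivation `D : R → S` along `f` amount to a ring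
morphism `a ↦ f(a) + D(a)ε` from `R` to the dual numbers of `S`. -/
def dualHom (f : R →+* S) (D : R →+ S) (h : ∀ a b, D (a * b) = f a * D b + f b * D a) :
    R →+* DualNumber S where
  __ := dualAddHom f.toAddMonoidHom D
  map_one' := by
    have h1 := h 1 1
    simp only [mul_one, map_one, one_mul, left_eq_add] at h1
    change dualAddHom f.toAddMonoidHom D 1 = 1
    ext <;> simp [h1]
  map_mul' a b := by
    change dualAddHom f.toAddMonoidHom D (a * b) =
      dualAddHom f.toAddMonoidHom D a * dualAddHom f.toAddMonoidHom D b
    ext <;> simp [h, mul_comm]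

@[simp]
theorem dualHom_fst (f : R →+* S) (D : R →+ S) (h) (a : R) :
    TrivSqZeroExt.fst (dualHom f D h a) = f a :=
  dualAddHom_fst _ _ _

@[simp]
theorem dualHom_snd (f : R →+* S) (D : R →+ S) (h) (a : R) :
    TrivSqZeroExt.snd (dualHom f D h a) = D a :=
  dualAddHom_snd _ _ _

/-- The ring morphism `T(R) → S` corresponding to a ring morphism `R → S[ε]`. -/
noncomputable def ofDual (g : R →+* DualNumber S) : TangentAlgebra R →+* S :=
  lift ((TrivSqZeroExt.fstHom S S S).toRingHom.comp g)
    ((TrivSqZeroExt.sndHom S S).toAddMonoidHom.comp g.toAddMonoidHom)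
    (by intro a b; simp [mul_comm])

@[simp]
theorem ofDual_incl (g : R →+* DualNumber S) (a : R) :
    ofDual g (incl R a) = TrivSqZeroExt.fst (g a) := by simp [ofDual]

@[simp]
theorem ofDual_d (g : R →+* DualNumber S) (a : R) :
    ofDual g (d R a) = TrivSqZeroExt.snd (g a) := by simp [ofDual]

/-- The ring morphism `R → S[ε]` corresponding to a ring morphism `T(R) → S`. -/
noncomputable def toDual (k : TangentAlgebra R →+* S) : R →+* DualNumber S :=
  dualHom (k.comp (incl R)) (k.toAddMonoidHom.comp (d R)) (by intro a b; simp [d_mul])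

@[simp]
theorem toDual_fst (k : TangentAlgebra R →+* S) (a : R) :
    TrivSqZeroExt.fst (toDual k a) = k (incl R a) :=
  dualHom_fst _ _ _ _

@[simp]
theorem toDual_snd (k : TangentAlgebra R →+* S) (a : R) :
    TrivSqZeroExt.snd (toDual k a) = k (d R a) :=
  dualHom_snd _ _ _ _

/-- The ring morphism `ℓ_R : T²(R) → T(R)`, with `a ↦ a`, `d(a) ↦ 0`, `d'(a) ↦ 0` and
`d'd(a) ↦ d(a)`. Here, for `a : R`, the four kinds of generators `a`, `d(a)`, `d'(a)`, `d'd(a)`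
of `T²(R)` are `incl (incl a)`, `incl (d a)`, `d (incl a)` and `d (d a)`. -/
noncomputable def liftHom (R : Type u) [CommRing R] :
    TangentAlgebra (TangentAlgebra R) →+* TangentAlgebra R :=
  ofDual (lift (dualHom (incl R) 0 (by simp))
    (dualAddHom 0 (d R))
    (by intro a b; ext <;> simp [d_mul, mul_comm]))

@[simp]
theorem liftHom_incl_incl (a : R) : liftHom R (incl _ (incl R a)) = incl R a := by simp [liftHom]

@[simp]
theorem liftHom_incl_d (a : R) : liftHom R (incl _ (d R a)) = 0 := by simp [liftHom]

@[simp]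
theorem liftHom_d_incl (a : R) : liftHom R (d _ (incl R a)) = 0 := by simp [liftHom]

@[simp]
theorem liftHom_d_d (a : R) : liftHom R (d _ (d R a)) = d R a := by simp [liftHom]

/-- The ring morphism `c_R : T²(R) → T²(R)`, with `a ↦ a`, `d(a) ↦ d'(a)`, `d'(a) ↦ d(a)` and
`d'd(a) ↦ d'd(a)`. -/
noncomputable def flipHom (R : Type u) [CommRing R] :
    TangentAlgebra (TangentAlgebra R) →+* TangentAlgebra (TangentAlgebra R) :=
  ofDual (lift (toDual (incl (TangentAlgebra R)))
    (dualAddHom ((d (TangentAlgebra R)).comp (incl R).toAddMonoidHom)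
      ((d (TangentAlgebra R)).comp (d R)))
    (by
      intro a b
      ext
      · simp [d_mul]
      · simp [d_mul]
        ring))

@[simp]
theorem flipHom_incl_incl (a : R) :
    flipHom R (incl _ (incl R a)) = incl _ (incl R a) := by simp [flipHom]

@[simp]
theorem flipHom_incl_d (a : R) : flipHom R (incl _ (d R a)) = d _ (incl R a) := by simp [flipHom]

@[simp]
theorem flipHom_d_incl (a : R) : flipHom R (d _ (incl R a)) = incl _ (d R a) := by simp [flipHom]

@[simp]
theorem flipHom_d_d (a : R) : flipHom R (d _ (d R a)) = d _ (d R a) := by simp [flipHom]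

theorem hom_ext₂ {f g : TangentAlgebra (TangentAlgebra R) →+* S}
    (h₀ : ∀ a, f (incl _ (incl R a)) = g (incl _ (incl R a)))
    (h₁ : ∀ a, f (incl _ (d R a)) = g (incl _ (d R a)))
    (h₂ : ∀ a, f (d _ (incl R a)) = g (d _ (incl R a)))
    (h₃ : ∀ a, f (d _ (d R a)) = g (d _ (d R a))) : f = g := by
  have hi : f.comp (incl (TangentAlgebra R)) = g.comp (incl (TangentAlgebra R)) := hom_ext h₀ h₁
  refine hom_ext (fun a => RingHom.congr_fun hi a) (fun a => ?_)
  have hd : toDual f = toDual g := by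
    refine hom_ext (fun a => ?_) (fun a => ?_) <;> ext
    · simpa using h₀ a
    · simpa using h₂ a
    · simpa using h₁ a
    · simpa using h₃ a
  simpa using congrArg TrivSqZeroExt.snd (RingHom.congr_fun hd a)

end TangentAlgebra

end TangentAlgebra

section AffineTangent

universe u

open TangentAlgebra fibrePow

/-- The functor `T : CRING ⥤ CRING`. -/
noncomputable def tangentAlgebraFunctor : CommRingCat.{u} ⥤ CommRingCat.{u} where
  obj R := CommRingCat.of (TangentAlgebra R)
  map f := CommRingCat.ofHom (TangentAlgebra.map f.hom)
  map_id R := by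
    ext : 1
    exact TangentAlgebra.hom_ext (by simp) (by simp)
  map_comp f g := by
    ext : 1
    exact TangentAlgebra.hom_ext (by simp) (by simp)

/-- The ring of dual numbers as a functor. -/
noncomputable def dualNumberFunctor : CommRingCat.{u} ⥤ CommRingCat.{u} where
  obj R := CommRingCat.of (DualNumber R)
  map {R S} f := CommRingCat.ofHom (TangentAlgebra.dualHom
    (f.hom.comp (TrivSqZeroExt.fstHom R R R).toRingHom)
    (f.hom.toAddMonoidHom.comp (TrivSqZeroExt.sndHom R R).toAddMonoidHom)
    (by intro a b; simp [mul_comm]))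
  map_id R := CommRingCat.hom_ext <| RingHom.ext fun a => TrivSqZeroExt.ext (by simp) (by simp)
  map_comp f g := CommRingCat.hom_ext <| RingHom.ext fun a =>
    TrivSqZeroExt.ext (by simp) (by simp)

theorem dualNumberFunctor_map_fst {R S : CommRingCat.{u}} (f : R ⟶ S) (x : DualNumber R) :
    TrivSqZeroExt.fst ((dualNumberFunctor.map f).hom x : DualNumber S) =
      f.hom (TrivSqZeroExt.fst x) :=
  dualHom_fst _ _ (by intro a b; simp [mul_comm]) x

theorem dualNumberFunctor_map_snd {R S : CommRingCat.{u}} (f : R ⟶ S) (x : DualNumber R) :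
    TrivSqZeroExt.snd ((dualNumberFunctor.map f).hom x : DualNumber S) =
      f.hom (TrivSqZeroExt.snd x) :=
  dualHom_snd _ _ (by intro a b; simp [mul_comm]) x

/-- `T` is left adjoint to the dual numbers functor. -/
noncomputable def tangentAlgebraAdjunction :
    tangentAlgebraFunctor.{u} ⊣ dualNumberFunctor.{u} :=
  Adjunction.mkOfHomEquiv
    { homEquiv := fun _ _ =>
        { toFun := fun k => CommRingCat.ofHom (toDual k.hom)
          invFun := fun g => CommRingCat.ofHom (ofDual g.hom)
          left_inv := fun k => CommRingCat.hom_ext <| TangentAlgebra.hom_ext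
            (fun a => (ofDual_incl (toDual k.hom) a).trans (toDual_fst k.hom a))
            (fun a => (ofDual_d (toDual k.hom) a).trans (toDual_snd k.hom a))
          right_inv := fun g => CommRingCat.hom_ext <| RingHom.ext fun a =>
            TrivSqZeroExt.ext ((toDual_fst (ofDual g.hom) a).trans (ofDual_incl g.hom a))
              ((toDual_snd (ofDual g.hom) a).trans (ofDual_d g.hom a)) }
      homEquiv_naturality_left_symm := fun f g =>
        CommRingCat.hom_ext <| TangentAlgebra.hom_ext
          (fun a => (ofDual_incl (g.hom.comp f.hom) a).trans
            ((ofDual_incl g.hom _).symm.trans (congrArg _ (map_incl f.hom a).symm)))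
          (fun a => (ofDual_d (g.hom.comp f.hom) a).trans
            ((ofDual_d g.hom _).symm.trans (congrArg _ (map_d f.hom a).symm)))
      homEquiv_naturality_right := fun f g => CommRingCat.hom_ext <| RingHom.ext fun a =>
        TrivSqZeroExt.ext
          ((toDual_fst (g.hom.comp f.hom) a).trans ((congrArg g.hom (toDual_fst f.hom a)).symm.trans
            (dualNumberFunctor_map_fst g (toDual f.hom a)).symm))
          ((toDual_snd (g.hom.comp f.hom) a).trans ((congrArg g.hom (toDual_snd f.hom a)).symm.trans
            (dualNumberFunctor_map_snd g (toDual f.hom a)).symm)) }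

instance : tangentAlgebraFunctor.{u}.IsLeftAdjoint := tangentAlgebraAdjunction.isLeftAdjoint

instance : tangentAlgebraFunctor.{u}.op.IsRightAdjoint := inferInstance

theorem iter_preserves {J : Type} [SmallCategory J] (K : J ⥤ CommRingCat.{u}ᵒᵖ) (n : ℕ) :
    PreservesLimit K (iterFunctor tangentAlgebraFunctor.{u}.op n) := by
  have h : PreservesLimitsOfSize.{0, 0} (iterFunctor tangentAlgebraFunctor.{u}.op n) := by
    induction n with
    | zero => exact inferInstanceAs (PreservesLimitsOfSize.{0, 0} (𝟭 _))
    | succ n ih =>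
      exact comp_preservesLimits (iterFunctor tangentAlgebraFunctor.{u}.op n)
        tangentAlgebraFunctor.{u}.op
  infer_instance

instance {E A : CommRingCat.{u}ᵒᵖ} (q : E ⟶ A) : HasFibrePowers q where
  hasWidePullback _ := inferInstance

instance {E A : CommRingCat.{u}ᵒᵖ} (q : E ⟶ A) :
    PreservesFibrePowers tangentAlgebraFunctor.{u}.op q where
  preservesLimit m _ := iter_preserves _ m

namespace AffineTangent

variable {R S : CommRingCat.{u}}

/-- The inclusion `p_R : R ⟶ T(R)` in `CRING`. -/
noncomputable def incl (R : CommRingCat.{u}) : R ⟶ tangentAlgebraFunctor.obj R :=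
  CommRingCat.ofHom (TangentAlgebra.incl R)

/-- The universal derivation `d : R → T(R)`. -/
noncomputable def d (R : CommRingCat.{u}) : R →+ tangentAlgebraFunctor.obj R :=
  TangentAlgebra.d R

theorem d_mul (a b : R) :
    d R (a * b) = (incl R).hom a * d R b + (incl R).hom b * d R a :=
  TangentAlgebra.d_mul a b

/-- The morphism `T(R) ⟶ S` with `a ↦ f(a)` and `d(a) ↦ D(a)`. -/
noncomputable def desc (f : R ⟶ S) (D : R →+ S)
    (h : ∀ a b, D (a * b) = f.hom a * D b + f.hom b * D a) : tangentAlgebraFunctor.obj R ⟶ S :=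
  CommRingCat.ofHom (TangentAlgebra.lift f.hom D h)

@[simp]
theorem desc_incl (f : R ⟶ S) (D : R →+ S) (h) (a : R) :
    (desc f D h).hom ((incl R).hom a) = f.hom a :=
  TangentAlgebra.lift_incl f.hom D h a

@[simp]
theorem desc_d (f : R ⟶ S) (D : R →+ S) (h) (a : R) : (desc f D h).hom (d R a) = D a :=
  TangentAlgebra.lift_d f.hom D h a

@[simp]
theorem map_incl (f : R ⟶ S) (a : R) :
    (tangentAlgebraFunctor.map f).hom ((incl R).hom a) = (incl S).hom (f.hom a) :=
  TangentAlgebra.map_incl f.hom a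

@[simp]
theorem map_d (f : R ⟶ S) (a : R) :
    (tangentAlgebraFunctor.map f).hom (d R a) = d S (f.hom a) :=
  TangentAlgebra.map_d f.hom a

theorem hom_ext {f g : tangentAlgebraFunctor.obj R ⟶ S}
    (hi : ∀ a, f.hom ((incl R).hom a) = g.hom ((incl R).hom a))
    (hd : ∀ a, f.hom (d R a) = g.hom (d R a)) : f = g :=
  CommRingCat.hom_ext (TangentAlgebra.hom_ext hi hd)

theorem hom_ext₂ {f g : tangentAlgebraFunctor.obj (tangentAlgebraFunctor.obj R) ⟶ S}
    (h₀ : ∀ a, f.hom ((incl _).hom ((incl R).hom a)) = g.hom ((incl _).hom ((incl R).hom a)))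
    (h₁ : ∀ a, f.hom ((incl _).hom (d R a)) = g.hom ((incl _).hom (d R a)))
    (h₂ : ∀ a, f.hom (d _ ((incl R).hom a)) = g.hom (d _ ((incl R).hom a)))
    (h₃ : ∀ a, f.hom (d _ (d R a)) = g.hom (d _ (d R a))) : f = g :=
  CommRingCat.hom_ext (TangentAlgebra.hom_ext₂ h₀ h₁ h₂ h₃)

theorem hom_ext₃ {f g : tangentAlgebraFunctor.obj (tangentAlgebraFunctor.obj
      (tangentAlgebraFunctor.obj R)) ⟶ S}
    (h₀ : ∀ a, f.hom ((incl _).hom ((incl _).hom ((incl R).hom a))) =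
      g.hom ((incl _).hom ((incl _).hom ((incl R).hom a))))
    (h₁ : ∀ a, f.hom ((incl _).hom ((incl _).hom (d R a))) =
      g.hom ((incl _).hom ((incl _).hom (d R a))))
    (h₂ : ∀ a, f.hom ((incl _).hom (d _ ((incl R).hom a))) =
      g.hom ((incl _).hom (d _ ((incl R).hom a))))
    (h₃ : ∀ a, f.hom ((incl _).hom (d _ (d R a))) = g.hom ((incl _).hom (d _ (d R a))))
    (h₄ : ∀ a, f.hom (d _ ((incl _).hom ((incl R).hom a))) =
      g.hom (d _ ((incl _).hom ((incl R).hom a))))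
    (h₅ : ∀ a, f.hom (d _ ((incl _).hom (d R a))) = g.hom (d _ ((incl _).hom (d R a))))
    (h₆ : ∀ a, f.hom (d _ (d _ ((incl R).hom a))) = g.hom (d _ (d _ ((incl R).hom a))))
    (h₇ : ∀ a, f.hom (d _ (d _ (d R a))) = g.hom (d _ (d _ (d R a)))) : f = g := by
  have hi : incl _ ≫ f = incl _ ≫ g := hom_ext₂ h₀ h₁ h₂ h₃
  have hd : CommRingCat.ofHom (toDual f.hom) = CommRingCat.ofHom (toDual g.hom) := by
    apply hom_ext₂ (R := R) (S := CommRingCat.of (DualNumber S))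
    · exact fun a => TrivSqZeroExt.ext
        ((toDual_fst f.hom _).trans ((h₀ a).trans (toDual_fst g.hom _).symm))
        ((toDual_snd f.hom _).trans ((h₄ a).trans (toDual_snd g.hom _).symm))
    · exact fun a => TrivSqZeroExt.ext
        ((toDual_fst f.hom _).trans ((h₁ a).trans (toDual_fst g.hom _).symm))
        ((toDual_snd f.hom _).trans ((h₅ a).trans (toDual_snd g.hom _).symm))
    · exact fun a => TrivSqZeroExt.ext
        ((toDual_fst f.hom _).trans ((h₂ a).trans (toDual_fst g.hom _).symm))
        ((toDual_snd f.hom _).trans ((h₆ a).trans (toDual_snd g.hom _).symm))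
    · exact fun a => TrivSqZeroExt.ext
        ((toDual_fst f.hom _).trans ((h₃ a).trans (toDual_fst g.hom _).symm))
        ((toDual_snd f.hom _).trans ((h₇ a).trans (toDual_snd g.hom _).symm))
  refine hom_ext (fun a => congrArg (fun k => k.hom a) hi) (fun a => ?_)
  exact (toDual_snd f.hom a).symm.trans
    ((congrArg (fun k => TrivSqZeroExt.snd (k.hom a)) hd).trans (toDual_snd g.hom a))

/-- The morphism `0_R : T(R) ⟶ R` in `CRING`. -/
noncomputable def zero (R : CommRingCat.{u}) : tangentAlgebraFunctor.obj R ⟶ R :=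
  CommRingCat.ofHom (zeroHom R)

@[simp]
theorem zero_incl (a : R) : (zero R).hom ((incl R).hom a) = a := zeroHom_incl a

@[simp]
theorem zero_d (a : R) : (zero R).hom (d R a) = 0 := zeroHom_d a

/-- The morphism `-_R : T(R) ⟶ T(R)` in `CRING`. -/
noncomputable def neg (R : CommRingCat.{u}) :
    tangentAlgebraFunctor.obj R ⟶ tangentAlgebraFunctor.obj R :=
  CommRingCat.ofHom (negHom R)

@[simp]
theorem neg_incl (a : R) : (neg R).hom ((incl R).hom a) = (incl R).hom a := negHom_incl a

@[simp]
theorem neg_d (a : R) : (neg R).hom (d R a) = -d R a := negHom_d a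

/-- The morphism `ℓ_R : T²(R) ⟶ T(R)` in `CRING`. -/
noncomputable def lift (R : CommRingCat.{u}) :
    tangentAlgebraFunctor.obj (tangentAlgebraFunctor.obj R) ⟶ tangentAlgebraFunctor.obj R :=
  CommRingCat.ofHom (liftHom R)

@[simp]
theorem lift_incl_incl (a : R) :
    (lift R).hom ((incl _).hom ((incl R).hom a)) = (incl R).hom a := liftHom_incl_incl a

@[simp]
theorem lift_incl_d (a : R) : (lift R).hom ((incl _).hom (d R a)) = 0 := liftHom_incl_d a

@[simp]
theorem lift_d_incl (a : R) : (lift R).hom (d _ ((incl R).hom a)) = 0 := liftHom_d_incl a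

@[simp]
theorem lift_d_d (a : R) : (lift R).hom (d _ (d R a)) = d R a := liftHom_d_d a

/-- The morphism `c_R : T²(R) ⟶ T²(R)` in `CRING`. -/
noncomputable def flip (R : CommRingCat.{u}) :
    tangentAlgebraFunctor.obj (tangentAlgebraFunctor.obj R) ⟶
      tangentAlgebraFunctor.obj (tangentAlgebraFunctor.obj R) :=
  CommRingCat.ofHom (flipHom R)

@[simp]
theorem flip_incl_incl (a : R) :
    (flip R).hom ((incl _).hom ((incl R).hom a)) = (incl _).hom ((incl R).hom a) :=
  flipHom_incl_incl a

@[simp]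
theorem flip_incl_d (a : R) :
    (flip R).hom ((incl _).hom (d R a)) = d _ ((incl R).hom a) := flipHom_incl_d a

@[simp]
theorem flip_d_incl (a : R) :
    (flip R).hom (d _ ((incl R).hom a)) = (incl _).hom (d R a) := flipHom_d_incl a

@[simp]
theorem flip_d_d (a : R) : (flip R).hom (d _ (d R a)) = d _ (d R a) := flipHom_d_d a

/-- The projection `p : T ⟶ 𝟭` in `CRINGᵒᵖ`. -/
noncomputable def opProj : tangentAlgebraFunctor.{u}.op ⟶ 𝟭 CommRingCat.{u}ᵒᵖ where
  app A := (incl A.unop).op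
  naturality _ _ f := Quiver.Hom.unop_inj <| CommRingCat.hom_ext <| RingHom.ext fun a =>
    map_incl f.unop a

/-- The zero `0 : 𝟭 ⟶ T` in `CRINGᵒᵖ`. -/
noncomputable def opZero : 𝟭 CommRingCat.{u}ᵒᵖ ⟶ tangentAlgebraFunctor.{u}.op where
  app A := (zero A.unop).op
  naturality _ _ f := Quiver.Hom.unop_inj <| hom_ext (by simp) (by simp)

/-- The negative `- : T ⟶ T` in `CRINGᵒᵖ`. -/
noncomputable def opNeg : tangentAlgebraFunctor.{u}.op ⟶ tangentAlgebraFunctor.{u}.op where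
  app A := (neg A.unop).op
  naturality _ _ f := Quiver.Hom.unop_inj <| hom_ext (by simp) (by simp)

/-- The vertical lift `ℓ : T ⟶ T²` in `CRINGᵒᵖ`. -/
noncomputable def opLift : tangentAlgebraFunctor.{u}.op ⟶
    tangentAlgebraFunctor.{u}.op ⋙ tangentAlgebraFunctor.{u}.op where
  app A := (lift A.unop).op
  naturality _ _ f := Quiver.Hom.unop_inj <| hom_ext₂ (by simp) (by simp) (by simp) (by simp)

/-- The canonical flip `c : T² ⟶ T²` in `CRINGᵒᵖ`. -/
noncomputable def opFlip : tangentAlgebraFunctor.{u}.op ⋙ tangentAlgebraFunctor.{u}.op ⟶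
    tangentAlgebraFunctor.{u}.op ⋙ tangentAlgebraFunctor.{u}.op where
  app A := (flip A.unop).op
  naturality _ _ f := Quiver.Hom.unop_inj <| hom_ext₂ (by simp) (by simp) (by simp) (by simp)

/-- For `f, g : T(R) ⟶ S` that agree on `R`, the morphism `T(R) ⟶ S` with `a ↦ f(a) = g(a)` and
`d(a) ↦ f(d(a)) + g(d(a))`. -/
noncomputable def addDesc (f g : tangentAlgebraFunctor.obj R ⟶ S)
    (h : incl R ≫ f = incl R ≫ g) : tangentAlgebraFunctor.obj R ⟶ S :=
  desc (incl R ≫ f) (f.hom.toAddMonoidHom.comp (d R) + g.hom.toAddMonoidHom.comp (d R))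
    (by
      intro a b
      have h' (a : R) : g.hom ((incl R).hom a) = f.hom ((incl R).hom a) :=
        congrArg (fun k => k.hom a) h.symm
      simp [d_mul, h']
      ring)

@[simp]
theorem addDesc_incl (f g : tangentAlgebraFunctor.obj R ⟶ S) (h) (a : R) :
    (addDesc f g h).hom ((incl R).hom a) = f.hom ((incl R).hom a) :=
  desc_incl _ _ _ a

@[simp]
theorem addDesc_d (f g : tangentAlgebraFunctor.obj R ⟶ S) (h) (a : R) :
    (addDesc f g h).hom (d R a) = f.hom (d R a) + g.hom (d R a) :=
  desc_d _ _ _ a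

/-- The object `T_n(R)` of `CRING`, the pushout of `n` copies of `p_R : R ⟶ T(R)`. -/
noncomputable abbrev pushoutObj (R : CommRingCat.{u}) (n : ℕ) : CommRingCat.{u} :=
  (fibrePow (opProj.app (op R)) n).unop

/-- The coprojections `T(R) ⟶ T_n(R)` in `CRING`. -/
noncomputable def coproj (R : CommRingCat.{u}) {n : ℕ} (i : Fin n) :
    tangentAlgebraFunctor.obj R ⟶ pushoutObj R n :=
  (proj (opProj.app (op R)) i).unop

theorem incl_coproj (R : CommRingCat.{u}) {n : ℕ} (i j : Fin n) :
    incl R ≫ coproj R i = incl R ≫ coproj R j :=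
  Quiver.Hom.op_inj (proj_comp (opProj.app (op R)) i j)

/-- The sum `+_R : T(R) ⟶ T_2(R)` in `CRING`, with `a ↦ a` and `d(a) ↦ π₁(d(a)) + π₂(d(a))`. -/
noncomputable def add (R : CommRingCat.{u}) :
    tangentAlgebraFunctor.obj R ⟶ pushoutObj R 2 :=
  addDesc (coproj R 0) (coproj R 1) (incl_coproj R 0 1)

@[simp]
theorem add_incl (a : R) :
    (add R).hom ((incl R).hom a) = (coproj R (0 : Fin 2)).hom ((incl R).hom a) :=
  addDesc_incl _ _ _ a

@[simp]
theorem add_d (a : R) :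
    (add R).hom (d R a) =
      (coproj R (0 : Fin 2)).hom (d R a) + (coproj R (1 : Fin 2)).hom (d R a) :=
  addDesc_d _ _ _ a

/-- The sum `+ : T_2 ⟶ T` in `CRINGᵒᵖ`. -/
noncomputable def opAdd (A : CommRingCat.{u}ᵒᵖ) :
    fibrePow (opProj.app A) 2 ⟶ tangentAlgebraFunctor.{u}.op.obj A :=
  (add A.unop).op

/-- The copairing `T_2(R) ⟶ S` of two morphisms that agree on `R`. -/
noncomputable def copair (f g : tangentAlgebraFunctor.obj R ⟶ S)
    (h : incl R ≫ f = incl R ≫ g) : pushoutObj R 2 ⟶ S :=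
  (pair (X := op S) (opProj.app (op R)) f.op g.op (congrArg Quiver.Hom.op h)).unop

theorem coproj_copair_zero (f g : tangentAlgebraFunctor.obj R ⟶ S)
    (h : incl R ≫ f = incl R ≫ g) : coproj R 0 ≫ copair f g h = f :=
  congrArg Quiver.Hom.unop (pair_zero (X := op S) (opProj.app (op R)) f.op g.op _)

theorem coproj_copair_one (f g : tangentAlgebraFunctor.obj R ⟶ S)
    (h : incl R ≫ f = incl R ≫ g) : coproj R 1 ≫ copair f g h = g :=
  congrArg Quiver.Hom.unop (pair_one (X := op S) (opProj.app (op R)) f.op g.op _)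

@[simp]
theorem copair_coproj_zero (f g : tangentAlgebraFunctor.obj R ⟶ S)
    (h : incl R ≫ f = incl R ≫ g) (x : tangentAlgebraFunctor.obj R) :
    (copair f g h).hom ((coproj R (0 : Fin 2)).hom x) = f.hom x :=
  congrArg (fun k => k.hom x) (coproj_copair_zero f g h)

@[simp]
theorem copair_coproj_one (f g : tangentAlgebraFunctor.obj R ⟶ S)
    (h : incl R ≫ f = incl R ≫ g) (x : tangentAlgebraFunctor.obj R) :
    (copair f g h).hom ((coproj R (1 : Fin 2)).hom x) = g.hom x :=
  congrArg (fun k => k.hom x) (coproj_copair_one f g h)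

/-- The copairing `T(T_2(R)) ⟶ S` of two morphisms that agree on `T(R)`. -/
noncomputable def mapCopair
    (f g : tangentAlgebraFunctor.obj (tangentAlgebraFunctor.obj R) ⟶ S)
    (h : tangentAlgebraFunctor.map (incl R) ≫ f = tangentAlgebraFunctor.map (incl R) ≫ g) :
    tangentAlgebraFunctor.obj (pushoutObj R 2) ⟶ S :=
  (mapPair (X := op S) (opProj.app (op R)) tangentAlgebraFunctor.op f.op g.op
    (congrArg Quiver.Hom.op h)).unop

theorem map_coproj_mapCopair_zero
    (f g : tangentAlgebraFunctor.obj (tangentAlgebraFunctor.obj R) ⟶ S)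
    (h : tangentAlgebraFunctor.map (incl R) ≫ f = tangentAlgebraFunctor.map (incl R) ≫ g) :
    tangentAlgebraFunctor.map (coproj R 0) ≫ mapCopair f g h = f :=
  congrArg Quiver.Hom.unop (mapPair_zero (X := op S) (opProj.app (op R))
    tangentAlgebraFunctor.op f.op g.op _)

theorem map_coproj_mapCopair_one
    (f g : tangentAlgebraFunctor.obj (tangentAlgebraFunctor.obj R) ⟶ S)
    (h : tangentAlgebraFunctor.map (incl R) ≫ f = tangentAlgebraFunctor.map (incl R) ≫ g) :
    tangentAlgebraFunctor.map (coproj R 1) ≫ mapCopair f g h = g :=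
  congrArg Quiver.Hom.unop (mapPair_one (X := op S) (opProj.app (op R))
    tangentAlgebraFunctor.op f.op g.op _)

section

variable (f g : tangentAlgebraFunctor.obj (tangentAlgebraFunctor.obj R) ⟶ S)
  (h : tangentAlgebraFunctor.map (incl R) ≫ f = tangentAlgebraFunctor.map (incl R) ≫ g)
  (x : tangentAlgebraFunctor.obj R)

@[simp]
theorem mapCopair_incl_zero :
    (mapCopair f g h).hom ((incl _).hom ((coproj R (0 : Fin 2)).hom x)) =
      f.hom ((incl _).hom x) := by
  conv_rhs => rw [← map_coproj_mapCopair_zero f g h]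
  simp

@[simp]
theorem mapCopair_incl_one :
    (mapCopair f g h).hom ((incl _).hom ((coproj R (1 : Fin 2)).hom x)) =
      g.hom ((incl _).hom x) := by
  conv_rhs => rw [← map_coproj_mapCopair_one f g h]
  simp

@[simp]
theorem mapCopair_d_zero :
    (mapCopair f g h).hom (d _ ((coproj R (0 : Fin 2)).hom x)) = f.hom (d _ x) := by
  conv_rhs => rw [← map_coproj_mapCopair_zero f g h]
  simp

@[simp]
theorem mapCopair_d_one :
    (mapCopair f g h).hom (d _ ((coproj R (1 : Fin 2)).hom x)) = g.hom (d _ x) := by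
  conv_rhs => rw [← map_coproj_mapCopair_one f g h]
  simp

end

theorem pushoutObj_hom_ext {k l : pushoutObj R 2 ⟶ S} (h₀ : coproj R 0 ≫ k = coproj R 0 ≫ l)
    (h₁ : coproj R 1 ≫ k = coproj R 1 ≫ l) : k = l :=
  Quiver.Hom.op_inj (fibrePow.hom_ext _ (congrArg Quiver.Hom.op h₀) (congrArg Quiver.Hom.op h₁))

theorem isAdditiveBundle (A : CommRingCat.{u}ᵒᵖ) :
    IsAdditiveBundle (opProj.app A) (opAdd A) (opZero.app A) where
  add_proj j := by
    have h : incl A.unop ≫ add A.unop = incl A.unop ≫ coproj A.unop j := by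
      rw [incl_coproj A.unop j 0]
      ext a
      simp
    exact congrArg Quiver.Hom.op h
  zero_proj := by
    have h : incl A.unop ≫ zero A.unop = 𝟙 A.unop := by
      ext a
      simp
    exact congrArg Quiver.Hom.op h
  add_assoc := by
    have h₀₁ := incl_coproj A.unop (0 : Fin 3) 1
    have h₁₂ := incl_coproj A.unop (1 : Fin 3) 2
    have h : add A.unop ≫ copair (add A.unop ≫ copair (coproj A.unop (0 : Fin 3))
          (coproj A.unop 1) h₀₁) (coproj A.unop 2) (by
            rw [← h₁₂, ← h₀₁]
            ext a
            simp) =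
        add A.unop ≫ copair (coproj A.unop (0 : Fin 3)) (add A.unop ≫
          copair (coproj A.unop (1 : Fin 3)) (coproj A.unop 2) h₁₂) (by
            rw [h₀₁]
            ext a
            simp) :=
      hom_ext (by simp) (by simp [_root_.add_assoc])
    exact congrArg Quiver.Hom.op h
  zero_add := by
    have h : add A.unop ≫ copair (zero A.unop ≫ incl A.unop) (𝟙 _) (by ext a; simp) = 𝟙 _ :=
      hom_ext (by simp) (by simp)
    exact congrArg Quiver.Hom.op h
  add_zero := by
    have h : add A.unop ≫ copair (𝟙 _) (zero A.unop ≫ incl A.unop) (by ext a; simp) = 𝟙 _ :=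
      hom_ext (by simp) (by simp)
    exact congrArg Quiver.Hom.op h
  add_comm := by
    have h : add A.unop ≫ copair (coproj A.unop 1) (coproj A.unop 0) (incl_coproj A.unop 1 0) =
        add A.unop := by
      refine hom_ext (fun a => ?_) (by simp [_root_.add_comm])
      simpa using congrArg (fun k => k.hom a) (incl_coproj A.unop (1 : Fin 2) 0)
    exact congrArg Quiver.Hom.op h

theorem isNegation (A : CommRingCat.{u}ᵒᵖ) :
    IsNegation (opProj.app A) (opAdd A) (opZero.app A) (opNeg.app A) where
  neg_proj := by
    have h : incl A.unop ≫ neg A.unop = incl A.unop := by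
      ext a
      simp
    exact congrArg Quiver.Hom.op h
  add_neg := by
    have h : add A.unop ≫ copair (𝟙 _) (neg A.unop) (by ext a; simp) =
        zero A.unop ≫ incl A.unop :=
      hom_ext (by simp) (by simp)
    exact congrArg Quiver.Hom.op h
  neg_add := by
    have h : add A.unop ≫ copair (neg A.unop) (𝟙 _) (by ext a; simp) =
        zero A.unop ≫ incl A.unop :=
      hom_ext (by simp) (by simp)
    exact congrArg Quiver.Hom.op h

theorem add_naturality (f : R ⟶ S) :
    tangentAlgebraFunctor.map f ≫ add S =
      add R ≫ copair (tangentAlgebraFunctor.map f ≫ coproj S 0)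
        (tangentAlgebraFunctor.map f ≫ coproj S 1)
        (by
          ext a
          simpa using congrArg (fun k => k.hom (f.hom a)) (incl_coproj S (0 : Fin 2) 1)) :=
  hom_ext (by simp) (by simp)

theorem map_incl_lift (R : CommRingCat.{u}) :
    tangentAlgebraFunctor.map (incl R) ≫ lift R = zero R ≫ incl R :=
  hom_ext (by simp) (by simp)

theorem map_incl_lift_coproj (R : CommRingCat.{u}) :
    tangentAlgebraFunctor.map (incl R) ≫ lift R ≫ coproj R (0 : Fin 2) =
      tangentAlgebraFunctor.map (incl R) ≫ lift R ≫ coproj R (1 : Fin 2) := by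
  rw [← Category.assoc, ← Category.assoc, map_incl_lift, Category.assoc, Category.assoc,
    incl_coproj R 0 1]

theorem map_add_mapCopair_lift (R : CommRingCat.{u}) :
    tangentAlgebraFunctor.map (add R) ≫
        mapCopair (lift R ≫ coproj R 0) (lift R ≫ coproj R 1) (map_incl_lift_coproj R) =
      lift R ≫ add R :=
  hom_ext₂ (by simp) (by simp) (by simp) (by simp)

theorem incl_flip (R : CommRingCat.{u}) :
    incl (tangentAlgebraFunctor.obj R) ≫ flip R = tangentAlgebraFunctor.map (incl R) :=
  hom_ext (by simp) (by simp)

theorem add_copair_flip (R : CommRingCat.{u}) :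
    add (tangentAlgebraFunctor.obj R) ≫
        copair (flip R ≫ tangentAlgebraFunctor.map (coproj R (0 : Fin 2)))
          (flip R ≫ tangentAlgebraFunctor.map (coproj R (1 : Fin 2)))
          (by
            rw [← Category.assoc, ← Category.assoc, incl_flip, ← Functor.map_comp,
              ← Functor.map_comp, incl_coproj R 0 1]) =
      flip R ≫ tangentAlgebraFunctor.map (add R) :=
  hom_ext₂ (by simp) (by simp) (by simp) (by simp)

/-- The dual of `ν`: the morphism `T²(R) ⟶ T_2(R)` in `CRING`. -/
noncomputable def nu (R : CommRingCat.{u}) :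
    tangentAlgebraFunctor.obj (tangentAlgebraFunctor.obj R) ⟶ pushoutObj R 2 :=
  tangentAlgebraFunctor.map (add R) ≫
    mapCopair (lift R ≫ coproj R 0) (zero (tangentAlgebraFunctor.obj R) ≫ coproj R 1) (by
      refine hom_ext (fun a => ?_) (by simp)
      simpa using congrArg (fun k => k.hom a) (incl_coproj R (0 : Fin 2) 1))

theorem nu_incl_incl (a : R) : (nu R).hom ((incl _).hom ((incl R).hom a)) =
    (coproj R (0 : Fin 2)).hom ((incl R).hom a) := by
  simp [nu]

theorem nu_incl_d (a : R) : (nu R).hom ((incl _).hom (d R a)) =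
    (coproj R (1 : Fin 2)).hom (d R a) := by
  simp [nu]

theorem nu_d_incl (a : R) : (nu R).hom (d _ ((incl R).hom a)) = 0 := by
  simp [nu]

theorem nu_d_d (a : R) : (nu R).hom (d _ (d R a)) =
    (coproj R (0 : Fin 2)).hom (d R a) := by
  simp [nu]

/-- The morphism `T(R) ⟶ S` with `a ↦ f(a)` and `d(a) ↦ g(d'd(a))`. -/
noncomputable def nuDesc (f : R ⟶ S)
    (g : tangentAlgebraFunctor.obj (tangentAlgebraFunctor.obj R) ⟶ S)
    (h : zero R ≫ f = tangentAlgebraFunctor.map (incl R) ≫ g) :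
    tangentAlgebraFunctor.obj R ⟶ S :=
  desc f (g.hom.toAddMonoidHom.comp ((d _).comp (d R))) (by
    have h₀ (a : R) : f.hom a = g.hom ((incl _).hom ((incl R).hom a)) := by
      simpa using congrArg (fun k => k.hom ((incl R).hom a)) h
    have h₁ (a : R) : g.hom (d _ ((incl R).hom a)) = 0 := by
      simpa using (congrArg (fun k => k.hom (d R a)) h).symm
    intro a b
    simp [d_mul, h₀, h₁])

theorem nu_isPushout (R : CommRingCat.{u}) (j : Fin 2) :
    IsPushout (tangentAlgebraFunctor.map (incl R)) (zero R) (nu R) (incl R ≫ coproj R j) := by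
  rw [incl_coproj R j 0]
  have w : tangentAlgebraFunctor.map (incl R) ≫ nu R = zero R ≫ incl R ≫ coproj R 0 :=
    hom_ext (by simp [nu_incl_incl]) (by simp [nu_d_incl])
  have key {S : CommRingCat.{u}}
      (g : tangentAlgebraFunctor.obj (tangentAlgebraFunctor.obj R) ⟶ S) (f : R ⟶ S)
      (h : tangentAlgebraFunctor.map (incl R) ≫ g = zero R ≫ f) :
      ∃ k : pushoutObj R 2 ⟶ S, nu R ≫ k = g ∧ (incl R ≫ coproj R 0) ≫ k = f := by
    have h₀ (a : R) : f.hom a = g.hom ((incl _).hom ((incl R).hom a)) := by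
      simpa using congrArg (fun k => k.hom ((incl R).hom a)) h.symm
    have h₁ (a : R) : g.hom (d _ ((incl R).hom a)) = 0 := by
      simpa using congrArg (fun k => k.hom (d R a)) h
    refine ⟨copair (nuDesc f g h.symm) (incl _ ≫ g) (by ext a; simp [nuDesc, h₀]), ?_, ?_⟩
    · refine hom_ext₂ (fun a => ?_) (fun a => ?_) (fun a => ?_) (fun a => ?_)
      · simp [nu_incl_incl, nuDesc, h₀]
      · simp [nu_incl_d]
      · simp [nu_d_incl, h₁]
      · simp [nu_d_d, nuDesc]
    · ext a
      simp [nuDesc]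
  have uniq {S : CommRingCat.{u}} {k l : pushoutObj R 2 ⟶ S} (h : nu R ≫ k = nu R ≫ l)
      (h' : (incl R ≫ coproj R 0) ≫ k = (incl R ≫ coproj R 0) ≫ l) : k = l := by
    have hi (a : R) : k.hom ((coproj R (0 : Fin 2)).hom ((incl R).hom a)) =
        l.hom ((coproj R (0 : Fin 2)).hom ((incl R).hom a)) :=
      congrArg (fun m => m.hom a) h'
    have hi' (a : R) : (coproj R (1 : Fin 2)).hom ((incl R).hom a) =
        (coproj R (0 : Fin 2)).hom ((incl R).hom a) :=
      congrArg (fun m => m.hom a) (incl_coproj R (1 : Fin 2) 0)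
    refine pushoutObj_hom_ext (hom_ext hi fun a => ?_)
      (hom_ext (fun a => by simpa [hi'] using hi a) fun a => ?_)
    · simpa [nu_d_d] using congrArg (fun m => m.hom (d _ (d R a))) h
    · simpa [nu_incl_d] using congrArg (fun m => m.hom ((incl _).hom (d R a))) h
  refine ⟨⟨w⟩, ⟨PushoutCocone.IsColimit.mk w (fun s => (key s.inl s.inr s.condition).choose)
    (fun s => (key s.inl s.inr s.condition).choose_spec.1)
    (fun s => (key s.inl s.inr s.condition).choose_spec.2) (fun s m hm hm' => ?_)⟩⟩
  exact uniq (hm.trans (key s.inl s.inr s.condition).choose_spec.1.symm)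
    (hm'.trans (key s.inl s.inr s.condition).choose_spec.2.symm)

end AffineTangent

open AffineTangent

/-- The tangent category of affine schemes: the tangent structure with negatives on `CRINGᵒᵖ`
given by `T(R) = Sym_R(Ω(R))`. -/
noncomputable def affineTangentStructure : RosickyTangentStructure CommRingCat.{u}ᵒᵖ where
  T := tangentAlgebraFunctor.op
  p := opProj
  hasFibrePowers _ := inferInstance
  preservesFibrePowers _ := inferInstance
  add := opAdd
  add_naturality f := congrArg Quiver.Hom.op (add_naturality f.unop)
  zero := opZero
  lift := opLift
  flip := opFlip
  isAdditiveBundle := isAdditiveBundle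
  lift_proj A := congrArg Quiver.Hom.op (map_incl_lift A.unop)
  lift_add A := congrArg Quiver.Hom.op (map_add_mapCopair_lift A.unop)
  lift_zero A := by
    have h : lift A.unop ≫ zero A.unop =
        tangentAlgebraFunctor.map (zero A.unop) ≫ zero A.unop :=
      hom_ext₂ (by simp) (by simp) (by simp) (by simp)
    exact congrArg Quiver.Hom.op h
  flip_proj A := congrArg Quiver.Hom.op (incl_flip A.unop)
  flip_add A := congrArg Quiver.Hom.op (add_copair_flip A.unop)
  flip_zero A := by
    have h : flip A.unop ≫ tangentAlgebraFunctor.map (zero A.unop) =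
        zero (tangentAlgebraFunctor.obj A.unop) :=
      hom_ext₂ (by simp) (by simp) (by simp) (by simp)
    exact congrArg Quiver.Hom.op h
  flip_flip A := by
    have h : flip A.unop ≫ flip A.unop = 𝟙 _ :=
      hom_ext₂ (by simp) (by simp) (by simp) (by simp)
    exact congrArg Quiver.Hom.op h
  flip_yangBaxter A := by
    have h : (tangentAlgebraFunctor.map (flip A.unop) ≫
          flip (tangentAlgebraFunctor.obj A.unop)) ≫ tangentAlgebraFunctor.map (flip A.unop) =
        (flip (tangentAlgebraFunctor.obj A.unop) ≫ tangentAlgebraFunctor.map (flip A.unop)) ≫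
          flip (tangentAlgebraFunctor.obj A.unop) :=
      hom_ext₃ (by simp) (by simp) (by simp) (by simp) (by simp) (by simp) (by simp) (by simp)
    exact congrArg Quiver.Hom.op h
  lift_lift A := by
    have h : lift (tangentAlgebraFunctor.obj A.unop) ≫ lift A.unop =
        tangentAlgebraFunctor.map (lift A.unop) ≫ lift A.unop :=
      hom_ext₃ (by simp) (by simp) (by simp) (by simp) (by simp) (by simp) (by simp) (by simp)
    exact congrArg Quiver.Hom.op h
  lift_flip A := by
    have h : flip A.unop ≫ lift A.unop = lift A.unop :=
      hom_ext₂ (by simp) (by simp) (by simp) (by simp)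
    exact congrArg Quiver.Hom.op h
  lift_flip_flip A := by
    have h : (flip (tangentAlgebraFunctor.obj A.unop) ≫
          tangentAlgebraFunctor.map (flip A.unop)) ≫ lift (tangentAlgebraFunctor.obj A.unop) =
        tangentAlgebraFunctor.map (lift A.unop) ≫ flip A.unop :=
      hom_ext₃ (by simp) (by simp) (by simp) (by simp) (by simp) (by simp) (by simp) (by simp)
    exact congrArg Quiver.Hom.op h
  lift_universal A j n := by
    have h : IsPullback (nu A.unop).op (incl A.unop ≫ coproj A.unop j).op
        (tangentAlgebraFunctor.map (incl A.unop)).op (zero A.unop).op :=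
      (nu_isPushout A.unop j).op.flip
    have : PreservesLimit (cospan (tangentAlgebraFunctor.map (incl A.unop)).op (zero A.unop).op)
        (iterFunctor tangentAlgebraFunctor.{u}.op n) := iter_preserves _ n
    exact h.map (iterFunctor tangentAlgebraFunctor.{u}.op n)
  neg := opNeg
  isNegation := isNegation

end AffineTangent

/-! ### Modules over varying commutative rings -/

section ModPair

universe u

/-- The objects of `MOD`: pairs `(R, M)` of a commutative ring `R` and an `R`-module `M`. -/
structure ModPair where
  /-- the ring -/
  ring : CommRingCat.{u}
  /-- the module -/
  mod : ModuleCat.{u} ring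

namespace ModPair

/-- A map `(R, M) ⟶ (R', M')` in `MOD`: a ring morphism `g : R ⟶ R'` and an additive map
`f : M → M'` with `f (a • m) = g a • f m`. -/
@[ext]
structure Hom (X Y : ModPair.{u}) where
  /-- the ring morphism -/
  g : X.ring ⟶ Y.ring
  /-- the map between the modules -/
  f : X.mod →+ Y.mod
  map_smul (a : X.ring) (m : X.mod) : f (a • m) = g.hom a • f m

instance : Category ModPair.{u} where
  Hom := Hom
  id X := ⟨𝟙 _, AddMonoidHom.id _, fun _ _ => rfl⟩
  comp F G := ⟨F.g ≫ G.g, G.f.comp F.f, fun a m => by simp [F.map_smul, G.map_smul]⟩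

/-- The functor `MOD ⥤ CRING`, `(R, M) ↦ R`. -/
def ringFunctor : ModPair.{u} ⥤ CommRingCat.{u} where
  obj X := X.ring
  map F := F.g

/-- The symmetric algebra `Sym_R(M)`, as a commutative ring. -/
noncomputable def sym (X : ModPair.{u}) : CommRingCat.{u} :=
  CommRingCat.of (SymmetricAlgebra X.ring X.mod)

/-- The structure morphism `R → Sym_R(M)`. -/
noncomputable def symIncl (X : ModPair.{u}) : X.ring →+* X.sym :=
  algebraMap X.ring (SymmetricAlgebra X.ring X.mod)

/-- The inclusion `M → Sym_R(M)` of the generators. -/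
noncomputable def symGen (X : ModPair.{u}) : X.mod →+ X.sym :=
  (SymmetricAlgebra.ι X.ring X.mod).toAddMonoidHom

/-- The ring morphism `Sym_R(M) ⟶ Sym_{R'}(M')` induced by a map `(R, M) ⟶ (R', M')`. -/
noncomputable def symMap {X Y : ModPair.{u}} (F : X ⟶ Y) : X.sym ⟶ Y.sym :=
  letI : Algebra X.ring (SymmetricAlgebra Y.ring Y.mod) := (Y.symIncl.comp F.g.hom).toAlgebra
  CommRingCat.ofHom (SymmetricAlgebra.lift (R := X.ring) (M := X.mod)
    (A := SymmetricAlgebra Y.ring Y.mod)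
    { toFun := fun m => SymmetricAlgebra.ι Y.ring Y.mod (F.f m)
      map_add' := fun m n => by rw [map_add, map_add]
      map_smul' := fun a m => by
        rw [F.map_smul, _root_.map_smul, Algebra.smul_def]
        rfl }).toRingHom

theorem symMap_incl {X Y : ModPair.{u}} (F : X ⟶ Y) (a : X.ring) :
    (symMap F).hom (X.symIncl a) = Y.symIncl (F.g.hom a) := by
  let _ : Algebra X.ring (SymmetricAlgebra Y.ring Y.mod) := (Y.symIncl.comp F.g.hom).toAlgebra
  exact AlgHom.commutes (SymmetricAlgebra.lift (R := X.ring) (M := X.mod)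
    (A := SymmetricAlgebra Y.ring Y.mod) _) a

theorem symMap_gen {X Y : ModPair.{u}} (F : X ⟶ Y) (m : X.mod) :
    (symMap F).hom (X.symGen m) = Y.symGen (F.f m) := by
  let _ : Algebra X.ring (SymmetricAlgebra Y.ring Y.mod) := (Y.symIncl.comp F.g.hom).toAlgebra
  exact SymmetricAlgebra.lift_ι_apply (R := X.ring) (M := X.mod)
    (A := SymmetricAlgebra Y.ring Y.mod) _ m

theorem sym_hom_ext {X : ModPair.{u}} {S : CommRingCat.{u}} {k l : X.sym ⟶ S}
    (hi : ∀ a, k.hom (X.symIncl a) = l.hom (X.symIncl a))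
    (hg : ∀ m, k.hom (X.symGen m) = l.hom (X.symGen m)) : k = l := by
  refine CommRingCat.hom_ext (RingHom.ext fun x => ?_)
  refine SymmetricAlgebra.induction (R := X.ring) (M := X.mod)
    (motive := fun x => k.hom x = l.hom x) hi hg ?_ ?_ x
  · intro x y hx hy
    exact (map_mul k.hom _ _).trans ((congrArg₂ _ hx hy).trans (map_mul l.hom _ _).symm)
  · intro x y hx hy
    exact (map_add k.hom _ _).trans ((congrArg₂ _ hx hy).trans (map_add l.hom _ _).symm)

/-- The functor `MOD ⥤ CRING`, `(R, M) ↦ Sym_R(M)`. -/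
noncomputable def symFunctor : ModPair.{u} ⥤ CommRingCat.{u} where
  obj X := X.sym
  map F := symMap F
  map_id X := sym_hom_ext (fun a => symMap_incl (𝟙 X) a) (fun m => symMap_gen (𝟙 X) m)
  map_comp F G := sym_hom_ext
    (fun a => (symMap_incl (F ≫ G) a).trans
      ((symMap_incl G _).symm.trans (congrArg (symMap G).hom (symMap_incl F a).symm)))
    (fun m => (symMap_gen (F ≫ G) m).trans
      ((symMap_gen G _).symm.trans (congrArg (symMap G).hom (symMap_gen F m).symm)))

end ModPair

open AffineTangent fibrePow

/-- Differential bundles in the tangent category of affine schemes. -/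
abbrev AffineDifferentialBundle : Type (u + 1) :=
  DifferentialBundle affineTangentStructure.{u}.toTangentStructure

/-- Differential bundles with negatives in the tangent category of affine schemes. -/
abbrev AffineDifferentialBundleWithNeg : Type (u + 1) :=
  DifferentialBundleWithNeg affineTangentStructure.{u}.toTangentStructure

/-- Under identifications `b` of `R` with the base ring and `t` of `Sym_R(M)` with the total ring,
the differential bundle `𝓔` is the bundle with total ring `Sym_R(M)` whose structure maps are, as
ring morphisms, given on the generators `a ∈ R` and `m ∈ M` by
`q(a) = a`, `σ(a) = π_j(a)`, `σ(m) = π₁(m) + π₂(m)`, `z(a) = a`, `z(m) = 0`, `λ(a) = a`, `λ(m) = 0`,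
`λ(d(a)) = 0`, `λ(d(m)) = m`, `-(a) = a`, `-(m) = -m`. -/
structure IsSymBundle (X : ModPair.{u}) (𝓔 : AffineDifferentialBundleWithNeg.{u})
    (b : X.ring ⟶ 𝓔.base.unop) (t : X.sym ⟶ 𝓔.total.unop) : Prop where
  q_incl (a : X.ring) : 𝓔.q.unop.hom (b.hom a) = t.hom (X.symIncl a)
  σ_incl (j : Fin 2) (a : X.ring) :
    𝓔.σ.unop.hom (t.hom (X.symIncl a)) = (proj 𝓔.q j).unop.hom (t.hom (X.symIncl a))
  σ_gen (m : X.mod) :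
    𝓔.σ.unop.hom (t.hom (X.symGen m)) =
      (proj 𝓔.q (0 : Fin 2)).unop.hom (t.hom (X.symGen m)) +
        (proj 𝓔.q (1 : Fin 2)).unop.hom (t.hom (X.symGen m))
  z_incl (a : X.ring) : 𝓔.z.unop.hom (t.hom (X.symIncl a)) = b.hom a
  z_gen (m : X.mod) : 𝓔.z.unop.hom (t.hom (X.symGen m)) = 0
  lam_incl (a : X.ring) :
    𝓔.lam.unop.hom ((incl 𝓔.total.unop).hom (t.hom (X.symIncl a))) = t.hom (X.symIncl a)
  lam_gen (m : X.mod) : 𝓔.lam.unop.hom ((incl 𝓔.total.unop).hom (t.hom (X.symGen m))) = 0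
  lam_d_incl (a : X.ring) : 𝓔.lam.unop.hom (d 𝓔.total.unop (t.hom (X.symIncl a))) = 0
  lam_d_gen (m : X.mod) :
    𝓔.lam.unop.hom (d 𝓔.total.unop (t.hom (X.symGen m))) = t.hom (X.symGen m)
  neg_incl (a : X.ring) : 𝓔.neg.unop.hom (t.hom (X.symIncl a)) = t.hom (X.symIncl a)
  neg_gen (m : X.mod) : 𝓔.neg.unop.hom (t.hom (X.symGen m)) = -t.hom (X.symGen m)

end ModPair

/-! Write a bundle in the opposite category as ring maps `q : A → E`, `z : E → A`, `λ : T(E) → E`.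
The map `D = λ ∘ d` is additive, and the bundle axioms turn into facts about it: `λ` restricted to
`E` is `q ∘ z`, so `D` is a derivation whose coefficients act through the augmentation `z`; it kills
`q(A)`; `z ∘ D = 0`; and `λ ∘ T(λ) = λ ∘ ℓ` gives `D ∘ D = D`.

In any tangent category the universality of the lift makes the total object the limit of maps `X ⟶
T(E)` that sit over `z` under `p` and over `0` under `T(q)` (`existsUnique_lift`). Dually, ring maps
`E → S` correspond bijectively to pairs of a ring map `g : A → S` and a derivation `δ : E → S` along
`g ∘ z` that vanishes on `q(A)`, the map `k` corresponding to `(k ∘ q, k ∘ D)`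
(`existsUnique_desc`). Let `M` be the `A`-module of fixed points of `D`, which is also its image.
The pair consisting of `A → Sym_A(M)` and `D` followed by `M → Sym_A(M)` yields a map `E →
Sym_A(M)`. It is inverse to the evident map back: one composite is checked on generators, the other
by uniqueness for the pair `(q, D)`. So every bundle is isomorphic to a symmetric algebra bundle
(`isIso_fromSym`, `isoSymBundle`).

For `E = Sym_R(M)` the image of `D` is exactly the copy of `M`, and `M` embeds in `Sym_R(M)`. A
bundle morphism commutes with `D`, hence restricts to the modules of generators, and this
restriction determines it. That gives full faithfulness (`exists_symMap_eq`, `symGen_injective`).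
Negatives cost nothing, because morphisms ignore them and the symmetric algebra bundles have them.

That `Sym_R(M)` is a bundle is checked on generators. A ring map `T(E) → S` is a ring map `E →
S[ε]`, so maps out of iterated `T` are also determined by generators. -/

section Tangent

universe v u

open fibrePow

variable {C : Type u} [Category.{v} C]

/-! ### Differential bundles in a general tangent category: the total object as a limit -/

namespace fibrePow

theorem mapPair_hom_ext {E A : C} (q : E ⟶ A) [HasFibrePowers q] (F : C ⥤ C)
    [PreservesFibrePowers F q] {X : C} {f g : X ⟶ F.obj (fibrePow q 2)}
    (h₀ : f ≫ F.map (proj q 0) = g ≫ F.map (proj q 0))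
    (h₁ : f ≫ F.map (proj q 1) = g ≫ F.map (proj q 1)) : f = g := by
  refine (isLimitOfPreserves F (limit.isLimit
    (WidePullbackShape.wideCospan A (fun _ : Fin 2 => E) (fun _ => q)))).hom_ext ?_
  have key : ∀ j : Fin 2, f ≫ F.map (proj q j) = g ≫ F.map (proj q j) := by
    intro j
    fin_cases j
    · exact h₀
    · exact h₁
  rintro (_ | j)
  -- The leg to the base object is a leg to `E` followed by `q`, so with two copies of `E` it is
  -- controlled by the leg `0`.
  · have h := congrArg (· ≫ F.map q) (key 0)
    simp only [Category.assoc, ← F.map_comp] at h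
    have hb : proj q (0 : Fin 2) ≫ q = limit.π
        (WidePullbackShape.wideCospan A (fun _ : Fin 2 => E) (fun _ => q)) none :=
      WidePullback.π_arrow (fun _ : Fin 2 => q) 0
    rw [hb] at h
    exact h
  · exact key j

end fibrePow

namespace DifferentialBundle

variable {𝕋 : TangentStructure C} (𝓔 : DifferentialBundle 𝕋)

theorem zero_app_comp_p (A : C) : 𝕋.zero.app A ≫ 𝕋.p.app A = 𝟙 A :=
  (𝕋.isAdditiveBundle A).zero_proj

/-- Both composites are the zero of `T(A)` over the common base point; this is what makes the
pairing inside `μ` well defined. -/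
theorem proj_lam_comp_map_q :
    (proj 𝓔.q 0 ≫ 𝓔.lam) ≫ 𝕋.T.map 𝓔.q =
      (proj 𝓔.q (1 : Fin 2) ≫ 𝕋.zero.app 𝓔.total) ≫ 𝕋.T.map 𝓔.q := by
  have h := 𝕋.zero.naturality 𝓔.q
  have h' := congrArg (· ≫ 𝕋.zero.app 𝓔.base) (proj_comp 𝓔.q (0 : Fin 2) 1)
  simp only [Functor.id_map, Functor.id_obj, Category.assoc] at h h'
  rw [Category.assoc, Category.assoc, ← h, 𝓔.lam_map_proj]
  exact h'

/-- The morphism `μ : E_2 ⟶ T(E)`. -/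
noncomputable def mu : fibrePow 𝓔.q 2 ⟶ 𝕋.T.obj 𝓔.total :=
  mapPair 𝓔.q 𝕋.T (proj 𝓔.q 0 ≫ 𝓔.lam) (proj 𝓔.q 1 ≫ 𝕋.zero.app 𝓔.total)
    𝓔.proj_lam_comp_map_q ≫ 𝕋.T.map 𝓔.σ

/-- This is the case `n = 0` of preserved universality, where the iterated functor is the identity.
-/
theorem mu_isPullback (j : Fin 2) :
    IsPullback 𝓔.mu (proj 𝓔.q j ≫ 𝓔.q) (𝕋.T.map 𝓔.q) (𝕋.zero.app 𝓔.base) :=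
  𝓔.lam_universal j 0

/-- By naturality `p` carries the sum in `T(E)` to a sum in `E`. There `λ(x)` has base point
`z(q(x))`, the neutral element, and the zero vector at `y` has base point `y`. -/
theorem mu_proj : 𝓔.mu ≫ 𝕋.p.app 𝓔.total = proj 𝓔.q 1 := by
  have hσ := 𝕋.p.naturality 𝓔.σ
  have hi (i : Fin 2) := 𝕋.p.naturality (proj 𝓔.q i)
  simp only [Functor.id_map, Functor.id_obj] at hσ hi
  have key : mapPair 𝓔.q 𝕋.T (proj 𝓔.q 0 ≫ 𝓔.lam) (proj 𝓔.q 1 ≫ 𝕋.zero.app 𝓔.total)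
      𝓔.proj_lam_comp_map_q ≫ 𝕋.p.app _ =
      proj 𝓔.q 1 ≫ pair 𝓔.q (𝓔.q ≫ 𝓔.z) (𝟙 _)
        (by simp [𝓔.isAdditiveBundle.zero_proj]) := by
    apply fibrePow.hom_ext
    · rw [Category.assoc, ← hi, ← Category.assoc, mapPair_zero, Category.assoc, Category.assoc,
        pair_zero, 𝓔.lam_proj, ← Category.assoc, ← Category.assoc, proj_comp 𝓔.q 0 1]
    · rw [Category.assoc, ← hi, ← Category.assoc, mapPair_one, Category.assoc, Category.assoc,
        pair_one, zero_app_comp_p]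
  rw [mu, Category.assoc, hσ, ← Category.assoc, key, Category.assoc,
    𝓔.isAdditiveBundle.zero_add, Category.comp_id]

/-- In element notation, `0(z(q(x))) = T(z)(0(q(x))) = T(z)(T(q)(λ(x)))`. The pair fed to `T(σ)` is
therefore `T` of `⟨1, z q⟩` applied to `λ(x)`, and the right unit law of `σ` finishes. -/
theorem pair_mu : pair 𝓔.q (𝟙 _) (𝓔.q ≫ 𝓔.z) (by simp [𝓔.isAdditiveBundle.zero_proj]) ≫ 𝓔.mu =
    𝓔.lam := by
  have key : pair 𝓔.q (𝟙 _) (𝓔.q ≫ 𝓔.z) (by simp [𝓔.isAdditiveBundle.zero_proj]) ≫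
      mapPair 𝓔.q 𝕋.T (proj 𝓔.q 0 ≫ 𝓔.lam) (proj 𝓔.q 1 ≫ 𝕋.zero.app 𝓔.total)
        𝓔.proj_lam_comp_map_q =
      𝓔.lam ≫ 𝕋.T.map (pair 𝓔.q (𝟙 _) (𝓔.q ≫ 𝓔.z)
        (by simp [𝓔.isAdditiveBundle.zero_proj])) := by
    apply mapPair_hom_ext
    · rw [Category.assoc, mapPair_zero, ← Category.assoc, pair_zero, Category.assoc,
        ← CategoryTheory.Functor.map_comp, pair_zero, CategoryTheory.Functor.map_id,
        Category.id_comp, Category.comp_id]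
    · have hz := 𝕋.zero.naturality 𝓔.z
      simp only [Functor.id_map, Functor.id_obj] at hz
      rw [Category.assoc, mapPair_one, ← Category.assoc, pair_one, Category.assoc,
        Category.assoc, ← 𝕋.T.map_comp, pair_one, 𝕋.T.map_comp, hz,
        ← Category.assoc, ← Category.assoc, 𝓔.lam_map_proj]
  rw [mu, ← Category.assoc, key, Category.assoc, ← 𝕋.T.map_comp, 𝓔.isAdditiveBundle.add_zero,
    CategoryTheory.Functor.map_id, Category.comp_id]

/-- The total object is the pullback of `(p, T(q))` along `(z, 0)`. -/
theorem existsUnique_lift {X : C} (f : X ⟶ 𝕋.T.obj 𝓔.total) (g : X ⟶ 𝓔.base)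
    (hp : f ≫ 𝕋.p.app 𝓔.total = g ≫ 𝓔.z) (hq : f ≫ 𝕋.T.map 𝓔.q = g ≫ 𝕋.zero.app 𝓔.base) :
    ∃! k : X ⟶ 𝓔.total, k ≫ 𝓔.q = g ∧ k ≫ 𝓔.lam = f := by
  have hz := 𝓔.isAdditiveBundle.zero_proj
  have H := 𝓔.mu_isPullback 0
  refine ⟨H.lift f g hq ≫ proj 𝓔.q 0, ⟨by rw [Category.assoc, H.lift_snd], ?_⟩, ?_⟩
  · have h₁ : H.lift f g hq ≫ proj 𝓔.q 1 =
        (H.lift f g hq ≫ proj 𝓔.q 0) ≫ 𝓔.q ≫ 𝓔.z := by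
      rw [← 𝓔.mu_proj, ← Category.assoc, H.lift_fst, hp]
      conv_lhs => rw [← H.lift_snd f g hq]
      simp only [Category.assoc]
    have h : H.lift f g hq = (H.lift f g hq ≫ proj 𝓔.q 0) ≫ pair 𝓔.q (𝟙 _) (𝓔.q ≫ 𝓔.z)
        (by simp [𝓔.isAdditiveBundle.zero_proj]) := by
      apply fibrePow.hom_ext
      · simp
      · rw [h₁]; simp
    conv_rhs => rw [← H.lift_fst f g hq, h]
    rw [Category.assoc _ _ 𝓔.mu, pair_mu]
  · rintro k ⟨hk, hk'⟩
    -- Any solution `k`, completed by the zero in the second slot, solves the pullback problem for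
    -- `(f, g)`.
    have h : k ≫ pair 𝓔.q (𝟙 _) (𝓔.q ≫ 𝓔.z) (by simp [𝓔.isAdditiveBundle.zero_proj]) =
        H.lift f g hq := by
      apply H.hom_ext
      · rw [H.lift_fst, Category.assoc, pair_mu, hk']
      · rw [H.lift_snd, Category.assoc, pair_comp, Category.id_comp, hk]
    rw [← h, Category.assoc, pair_zero, Category.comp_id]

end DifferentialBundle

instance (𝕋 : TangentStructure C) : (DifferentialBundleWithNeg.forgetNeg 𝕋).Full :=
  inferInstanceAs (inducedFunctor DifferentialBundleWithNeg.toDifferentialBundle).Full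

instance (𝕋 : TangentStructure C) : (DifferentialBundleWithNeg.forgetNeg 𝕋).Faithful :=
  inferInstanceAs (inducedFunctor DifferentialBundleWithNeg.toDifferentialBundle).Faithful

end Tangent

/-! ### Fibre powers in the opposite category as pushouts of rings -/

section CofibrePowers

universe u

namespace AffineTangent

open TangentAlgebra fibrePow

variable {A E S : CommRingCat.{u}} (q : A ⟶ E)

/-- Since `T` is left adjoint to `S ↦ S[ε]`, this trades one layer of `T` in the source for dual
numbers in the target, where an extensionality lemma for maps out of `E` applies. -/
theorem hom_ext_of_toDual {k l : tangentAlgebraFunctor.obj E ⟶ S}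
    (h : CommRingCat.ofHom (toDual k.hom) = CommRingCat.ofHom (toDual l.hom)) : k = l :=
  AffineTangent.hom_ext
    (fun a => (toDual_fst k.hom a).symm.trans
      ((congrArg (fun r => TrivSqZeroExt.fst (r.hom a)) h).trans (toDual_fst l.hom a)))
    (fun a => (toDual_snd k.hom a).symm.trans
      ((congrArg (fun r => TrivSqZeroExt.snd (r.hom a)) h).trans (toDual_snd l.hom a)))

theorem toDual_congr {k l : tangentAlgebraFunctor.obj E ⟶ S} {x : E}
    (hi : k.hom ((incl E).hom x) = l.hom ((incl E).hom x))
    (hd : k.hom (d E x) = l.hom (d E x)) : toDual k.hom x = toDual l.hom x :=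
  TrivSqZeroExt.ext ((toDual_fst k.hom x).trans (hi.trans (toDual_fst l.hom x).symm))
    ((toDual_snd k.hom x).trans (hd.trans (toDual_snd l.hom x).symm))

/-- The pushout of `n` copies of the ring morphism `q : A ⟶ E`. -/
noncomputable abbrev copow (n : ℕ) : CommRingCat.{u} := (fibrePow q.op n).unop

/-- The coprojections `E ⟶ E ⊗ ⋯ ⊗ E`. -/
noncomputable def copowProj {n : ℕ} (i : Fin n) : E ⟶ copow q n := (proj q.op i).unop

theorem comp_copowProj {n : ℕ} (i j : Fin n) : q ≫ copowProj q i = q ≫ copowProj q j :=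
  Quiver.Hom.op_inj (proj_comp q.op i j)

/-- The copairing `E ⊗ E ⟶ S` of two morphisms that agree on `A`. -/
noncomputable def copowPair (f g : E ⟶ S) (h : q ≫ f = q ≫ g) : copow q 2 ⟶ S :=
  (pair (X := op S) q.op f.op g.op (congrArg Quiver.Hom.op h)).unop

@[simp]
theorem copowPair_zero (f g : E ⟶ S) (h : q ≫ f = q ≫ g) (x : E) :
    (copowPair q f g h).hom ((copowProj q (0 : Fin 2)).hom x) = f.hom x :=
  congrArg (fun k => k.unop.hom x) (pair_zero (X := op S) q.op f.op g.op
    (congrArg Quiver.Hom.op h))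

@[simp]
theorem copowPair_one (f g : E ⟶ S) (h : q ≫ f = q ≫ g) (x : E) :
    (copowPair q f g h).hom ((copowProj q (1 : Fin 2)).hom x) = g.hom x :=
  congrArg (fun k => k.unop.hom x) (pair_one (X := op S) q.op f.op g.op
    (congrArg Quiver.Hom.op h))

theorem copow_hom_ext {k l : copow q 2 ⟶ S} (h₀ : copowProj q 0 ≫ k = copowProj q 0 ≫ l)
    (h₁ : copowProj q 1 ≫ k = copowProj q 1 ≫ l) : k = l :=
  Quiver.Hom.op_inj (fibrePow.hom_ext _ (congrArg Quiver.Hom.op h₀) (congrArg Quiver.Hom.op h₁))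

/-- The copairing `T(E ⊗ E) ⟶ S` of two morphisms that agree on `T(A)`. -/
noncomputable def copowMapPair (f g : tangentAlgebraFunctor.obj E ⟶ S)
    (h : tangentAlgebraFunctor.map q ≫ f = tangentAlgebraFunctor.map q ≫ g) :
    tangentAlgebraFunctor.obj (copow q 2) ⟶ S :=
  (mapPair (X := op S) q.op tangentAlgebraFunctor.op f.op g.op (congrArg Quiver.Hom.op h)).unop

section

variable (f g : tangentAlgebraFunctor.obj E ⟶ S)
  (h : tangentAlgebraFunctor.map q ≫ f = tangentAlgebraFunctor.map q ≫ g)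

theorem map_copowProj_copowMapPair_zero :
    tangentAlgebraFunctor.map (copowProj q 0) ≫ copowMapPair q f g h = f :=
  congrArg Quiver.Hom.unop (mapPair_zero (X := op S) q.op
    tangentAlgebraFunctor.op f.op g.op (congrArg Quiver.Hom.op h))

theorem map_copowProj_copowMapPair_one :
    tangentAlgebraFunctor.map (copowProj q 1) ≫ copowMapPair q f g h = g :=
  congrArg Quiver.Hom.unop (mapPair_one (X := op S) q.op
    tangentAlgebraFunctor.op f.op g.op (congrArg Quiver.Hom.op h))

@[simp]
theorem copowMapPair_incl_zero (x : E) :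
    (copowMapPair q f g h).hom ((incl _).hom ((copowProj q (0 : Fin 2)).hom x)) =
      f.hom ((incl _).hom x) := by
  conv_rhs => rw [← map_copowProj_copowMapPair_zero q f g h]
  simp

@[simp]
theorem copowMapPair_incl_one (x : E) :
    (copowMapPair q f g h).hom ((incl _).hom ((copowProj q (1 : Fin 2)).hom x)) =
      g.hom ((incl _).hom x) := by
  conv_rhs => rw [← map_copowProj_copowMapPair_one q f g h]
  simp

@[simp]
theorem copowMapPair_d_zero (x : E) :
    (copowMapPair q f g h).hom (d _ ((copowProj q (0 : Fin 2)).hom x)) = f.hom (d _ x) := by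
  conv_rhs => rw [← map_copowProj_copowMapPair_zero q f g h]
  simp

@[simp]
theorem copowMapPair_d_one (x : E) :
    (copowMapPair q f g h).hom (d _ ((copowProj q (1 : Fin 2)).hom x)) = g.hom (d _ x) := by
  conv_rhs => rw [← map_copowProj_copowMapPair_one q f g h]
  simp

end

end AffineTangent

end CofibrePowers

/-! ### The differential bundle with total ring `Sym_R(M)` -/

section SymBundle

universe u

open AffineTangent fibrePow

namespace ModPair

variable (X : ModPair.{u}) {S : CommRingCat.{u}}

/-- The morphism `R ⟶ Sym_R(M)`. -/
noncomputable def symInclHom : X.ring ⟶ X.sym := CommRingCat.ofHom X.symIncl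

@[simp]
theorem symInclHom_apply (a : X.ring) : X.symInclHom.hom a = X.symIncl a := rfl

theorem symGen_smul (a : X.ring) (m : X.mod) : X.symGen (a • m) = X.symIncl a * X.symGen m :=
  ((SymmetricAlgebra.ι X.ring X.mod).map_smul a m).trans (Algebra.smul_def _ _)

/-- The square-zero extension `R ⊕ M` is a commutative `R`-algebra containing `M`, and the algebra
map `Sym_R(M) → R ⊕ M` extending this inclusion separates the generators. -/
theorem symGen_injective : Function.Injective X.symGen := by
  -- The multiplication of a square-zero extension uses a right action as well; here it is the left
  -- action read backwards.
  let _ : Module X.ringᵐᵒᵖ X.mod := Module.compHom _ ((RingHom.id X.ring).fromOpposite mul_comm)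
  have _ : IsCentralScalar X.ring X.mod := ⟨fun _ _ => rfl⟩
  intro m n h
  have h' := congrArg (SymmetricAlgebra.lift (TrivSqZeroExt.inrHom X.ring X.mod)) h
  change SymmetricAlgebra.lift _ (SymmetricAlgebra.ι _ _ m) =
    SymmetricAlgebra.lift _ (SymmetricAlgebra.ι _ _ n) at h'
  rw [SymmetricAlgebra.lift_ι_apply, SymmetricAlgebra.lift_ι_apply] at h'
  exact TrivSqZeroExt.inr_injective h'

variable {X}

/-- A ring morphism `f : R ⟶ S` and an additive map `D : M → S` that is linear along `f` induce
a morphism `Sym_R(M) ⟶ S`. -/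
noncomputable def symDesc (f : X.ring ⟶ S) (D : X.mod →+ S)
    (h : ∀ a m, D (a • m) = f.hom a * D m) : X.sym ⟶ S :=
  letI : Algebra X.ring S := f.hom.toAlgebra
  CommRingCat.ofHom (SymmetricAlgebra.lift (R := X.ring) (M := X.mod) (A := S)
    { D with map_smul' := fun a m => (h a m).trans (Algebra.smul_def a (D m)).symm }).toRingHom

@[simp]
theorem symDesc_incl (f : X.ring ⟶ S) (D : X.mod →+ S) (h) (a : X.ring) :
    (symDesc f D h).hom (X.symIncl a) = f.hom a := by
  let _ : Algebra X.ring S := f.hom.toAlgebra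
  exact AlgHom.commutes (SymmetricAlgebra.lift (R := X.ring) (M := X.mod) (A := S) _) a

@[simp]
theorem symDesc_gen (f : X.ring ⟶ S) (D : X.mod →+ S) (h) (m : X.mod) :
    (symDesc f D h).hom (X.symGen m) = D m := by
  let _ : Algebra X.ring S := f.hom.toAlgebra
  exact SymmetricAlgebra.lift_ι_apply (R := X.ring) (M := X.mod) (A := S) _ m

/-- Extensionality for `Sym_R(M)`, applied to maps into `S[ε]`: the values on `x` and on `d(x)` are
the two components of one dual number. -/
theorem tangent_sym_hom_ext {k l : tangentAlgebraFunctor.obj X.sym ⟶ S}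
    (h₀ : ∀ a, k.hom ((incl _).hom (X.symIncl a)) = l.hom ((incl _).hom (X.symIncl a)))
    (h₁ : ∀ m, k.hom ((incl _).hom (X.symGen m)) = l.hom ((incl _).hom (X.symGen m)))
    (h₂ : ∀ a, k.hom (d _ (X.symIncl a)) = l.hom (d _ (X.symIncl a)))
    (h₃ : ∀ m, k.hom (d _ (X.symGen m)) = l.hom (d _ (X.symGen m))) : k = l := by
  refine hom_ext_of_toDual (sym_hom_ext (S := CommRingCat.of (DualNumber S)) ?_ ?_)
  · exact fun a => toDual_congr (h₀ a) (h₂ a)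
  · exact fun m => toDual_congr (h₁ m) (h₃ m)

theorem tangent_tangent_sym_hom_ext
    {k l : tangentAlgebraFunctor.obj (tangentAlgebraFunctor.obj X.sym) ⟶ S}
    (h₀ : ∀ a, k.hom ((incl _).hom ((incl _).hom (X.symIncl a))) =
      l.hom ((incl _).hom ((incl _).hom (X.symIncl a))))
    (h₁ : ∀ a, k.hom ((incl _).hom ((incl _).hom (X.symGen a))) =
      l.hom ((incl _).hom ((incl _).hom (X.symGen a))))
    (h₂ : ∀ a, k.hom ((incl _).hom (d _ (X.symIncl a))) =
      l.hom ((incl _).hom (d _ (X.symIncl a))))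
    (h₃ : ∀ a, k.hom ((incl _).hom (d _ (X.symGen a))) =
      l.hom ((incl _).hom (d _ (X.symGen a))))
    (h₄ : ∀ a, k.hom (d _ ((incl _).hom (X.symIncl a))) =
      l.hom (d _ ((incl _).hom (X.symIncl a))))
    (h₅ : ∀ a, k.hom (d _ ((incl _).hom (X.symGen a))) =
      l.hom (d _ ((incl _).hom (X.symGen a))))
    (h₆ : ∀ a, k.hom (d _ (d _ (X.symIncl a))) =
      l.hom (d _ (d _ (X.symIncl a))))
    (h₇ : ∀ a, k.hom (d _ (d _ (X.symGen a))) =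
      l.hom (d _ (d _ (X.symGen a)))) : k = l := by
  refine hom_ext_of_toDual (tangent_sym_hom_ext (S := CommRingCat.of (DualNumber S)) ?_ ?_ ?_ ?_)
  · exact fun a => toDual_congr (h₀ a) (h₄ a)
  · exact fun a => toDual_congr (h₁ a) (h₅ a)
  · exact fun a => toDual_congr (h₂ a) (h₆ a)
  · exact fun a => toDual_congr (h₃ a) (h₇ a)

variable (X)

/-- The coprojections `Sym_R(M) ⟶ Sym_R(M) ⊗_R ⋯ ⊗_R Sym_R(M)`. -/
noncomputable abbrev symProj {n : ℕ} (i : Fin n) : X.sym ⟶ copow X.symInclHom n :=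
  copowProj X.symInclHom i

theorem symProj_incl {n : ℕ} (i j : Fin n) (a : X.ring) :
    (X.symProj i).hom (X.symIncl a) = (X.symProj j).hom (X.symIncl a) :=
  congrArg (fun k => k.hom a) (comp_copowProj X.symInclHom i j)

@[simp]
-- As a rewriting rule, this moves all scalars into the copy `0` of the pushout, so that the
-- generator checks below close by `simp`.
theorem symProj_one_incl (a : X.ring) :
    (copowProj X.symInclHom (1 : Fin 2)).hom (X.symIncl a) =
      (copowProj X.symInclHom (0 : Fin 2)).hom (X.symIncl a) :=
  X.symProj_incl 1 0 a

/-- The morphism `σ`, with `a ↦ a` and `m ↦ π₁(m) + π₂(m)`. -/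
noncomputable def symAdd : X.sym ⟶ copow X.symInclHom 2 :=
  symDesc (X.symInclHom ≫ X.symProj 0)
    ((X.symProj 0).hom.toAddMonoidHom.comp X.symGen +
      (X.symProj 1).hom.toAddMonoidHom.comp X.symGen)
    (fun a m => by simp [symGen_smul, mul_add])

@[simp]
theorem symAdd_incl (a : X.ring) :
    X.symAdd.hom (X.symIncl a) = (copowProj X.symInclHom (0 : Fin 2)).hom (X.symIncl a) :=
  symDesc_incl _ _ _ a

@[simp]
theorem symAdd_gen (m : X.mod) :
    X.symAdd.hom (X.symGen m) = (copowProj X.symInclHom (0 : Fin 2)).hom (X.symGen m) +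
      (copowProj X.symInclHom (1 : Fin 2)).hom (X.symGen m) :=
  symDesc_gen _ _ _ m

/-- The morphism `z`, with `a ↦ a` and `m ↦ 0`. -/
noncomputable def symZero : X.sym ⟶ X.ring := symDesc (𝟙 _) 0 (by simp)

@[simp]
theorem symZero_incl (a : X.ring) : X.symZero.hom (X.symIncl a) = a := symDesc_incl _ _ _ a

@[simp]
theorem symZero_gen (m : X.mod) : X.symZero.hom (X.symGen m) = 0 := symDesc_gen _ _ _ m

/-- The morphism `ι`, with `a ↦ a` and `m ↦ -m`. -/
noncomputable def symNeg : X.sym ⟶ X.sym :=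
  symDesc X.symInclHom (-X.symGen) (by simp [symGen_smul])

@[simp]
theorem symNeg_incl (a : X.ring) : X.symNeg.hom (X.symIncl a) = X.symIncl a :=
  symDesc_incl _ _ _ a

@[simp]
theorem symNeg_gen (m : X.mod) : X.symNeg.hom (X.symGen m) = -X.symGen m :=
  symDesc_gen _ _ _ m

/-- The morphism `Sym_R(M) ⟶ Sym_R(M)[ε]`, with `a ↦ a` and `m ↦ mε`. -/
noncomputable def symDual : X.sym ⟶ CommRingCat.of (DualNumber X.sym) :=
  symDesc (CommRingCat.ofHom ((TrivSqZeroExt.inlHom X.sym X.sym).comp X.symIncl))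
    ((TrivSqZeroExt.inrHom X.sym X.sym).toAddMonoidHom.comp X.symGen)
    (fun a m => TrivSqZeroExt.ext (by simp) (by simp [symGen_smul, mul_comm]))

/-- The morphism `λ`, with `a ↦ a`, `m ↦ 0`, `d(a) ↦ 0` and `d(m) ↦ m`. -/
noncomputable def symLam : tangentAlgebraFunctor.obj X.sym ⟶ X.sym :=
  CommRingCat.ofHom (TangentAlgebra.ofDual X.symDual.hom)

@[simp]
theorem symLam_incl_incl (a : X.ring) :
    X.symLam.hom ((incl _).hom (X.symIncl a)) = X.symIncl a :=
  (TangentAlgebra.ofDual_incl X.symDual.hom _).trans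
    ((congrArg TrivSqZeroExt.fst (symDesc_incl (X := X) _ _ _ a)).trans
      (TrivSqZeroExt.fst_inl _ _))

@[simp]
theorem symLam_incl_gen (m : X.mod) : X.symLam.hom ((incl _).hom (X.symGen m)) = 0 :=
  (TangentAlgebra.ofDual_incl X.symDual.hom _).trans
    ((congrArg TrivSqZeroExt.fst (symDesc_gen (X := X) _ _ _ m)).trans
      (TrivSqZeroExt.fst_inr _ _))

@[simp]
theorem symLam_d_incl (a : X.ring) : X.symLam.hom (d _ (X.symIncl a)) = 0 :=
  (TangentAlgebra.ofDual_d X.symDual.hom _).trans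
    ((congrArg TrivSqZeroExt.snd (symDesc_incl (X := X) _ _ _ a)).trans
      (TrivSqZeroExt.snd_inl _ _))

@[simp]
theorem symLam_d_gen (m : X.mod) : X.symLam.hom (d _ (X.symGen m)) = X.symGen m :=
  (TangentAlgebra.ofDual_d X.symDual.hom _).trans
    ((congrArg TrivSqZeroExt.snd (symDesc_gen (X := X) _ _ _ m)).trans
      (TrivSqZeroExt.snd_inr _ _))

theorem map_symInclHom_symLam :
    tangentAlgebraFunctor.map X.symInclHom ≫ X.symLam = zero X.ring ≫ X.symInclHom :=
  AffineTangent.hom_ext (by simp) (by simp)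

theorem incl_symLam : incl X.sym ≫ X.symLam = X.symZero ≫ X.symInclHom :=
  sym_hom_ext (by simp) (by simp)

theorem sym_isAdditiveBundle :
    IsAdditiveBundle X.symInclHom.op (X.symAdd.op : fibrePow X.symInclHom.op 2 ⟶ op X.sym)
      X.symZero.op where
  add_proj j := by
    have h : X.symInclHom ≫ X.symAdd = X.symInclHom ≫ X.symProj j := by
      rw [comp_copowProj X.symInclHom j 0]
      ext a
      simp
    exact congrArg Quiver.Hom.op h
  zero_proj := by
    have h : X.symInclHom ≫ X.symZero = 𝟙 X.ring := by
      ext a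
      simp
    exact congrArg Quiver.Hom.op h
  add_assoc := by
    have h₀₁ := comp_copowProj X.symInclHom (0 : Fin 3) 1
    have h₁₂ := comp_copowProj X.symInclHom (1 : Fin 3) 2
    have h : X.symAdd ≫ copowPair X.symInclHom (X.symAdd ≫ copowPair X.symInclHom
          (X.symProj (0 : Fin 3)) (X.symProj 1) h₀₁) (X.symProj 2) (by
            rw [← h₁₂, ← h₀₁]
            ext a
            simp) =
        X.symAdd ≫ copowPair X.symInclHom (X.symProj (0 : Fin 3)) (X.symAdd ≫
          copowPair X.symInclHom (X.symProj (1 : Fin 3)) (X.symProj 2) h₁₂) (by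
            rw [h₀₁]
            ext a
            simp) :=
      sym_hom_ext (by simp) (by simp [_root_.add_assoc])
    exact congrArg Quiver.Hom.op h
  zero_add := by
    have h : X.symAdd ≫ copowPair X.symInclHom (X.symZero ≫ X.symInclHom) (𝟙 _)
        (by ext a; simp) = 𝟙 _ :=
      sym_hom_ext (by simp) (by simp)
    exact congrArg Quiver.Hom.op h
  add_zero := by
    have h : X.symAdd ≫ copowPair X.symInclHom (𝟙 _) (X.symZero ≫ X.symInclHom)
        (by ext a; simp) = 𝟙 _ :=
      sym_hom_ext (by simp) (by simp)
    exact congrArg Quiver.Hom.op h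
  add_comm := by
    have h : X.symAdd ≫ copowPair X.symInclHom (X.symProj 1) (X.symProj 0)
        (comp_copowProj X.symInclHom 1 0) = X.symAdd :=
      sym_hom_ext (by simp) (by simp [_root_.add_comm])
    exact congrArg Quiver.Hom.op h

theorem sym_isNegation :
    IsNegation X.symInclHom.op (X.symAdd.op : fibrePow X.symInclHom.op 2 ⟶ op X.sym)
      X.symZero.op X.symNeg.op where
  neg_proj := by
    have h : X.symInclHom ≫ X.symNeg = X.symInclHom := by
      ext a
      simp
    exact congrArg Quiver.Hom.op h
  add_neg := by
    have h : X.symAdd ≫ copowPair X.symInclHom (𝟙 _) X.symNeg (by ext a; simp) =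
        X.symZero ≫ X.symInclHom :=
      sym_hom_ext (by simp) (by simp)
    exact congrArg Quiver.Hom.op h
  neg_add := by
    have h : X.symAdd ≫ copowPair X.symInclHom X.symNeg (𝟙 _) (by ext a; simp) =
        X.symZero ≫ X.symInclHom :=
      sym_hom_ext (by simp) (by simp)
    exact congrArg Quiver.Hom.op h

theorem map_symInclHom_symLam_symProj :
    tangentAlgebraFunctor.map X.symInclHom ≫ X.symLam ≫ X.symProj (0 : Fin 2) =
      tangentAlgebraFunctor.map X.symInclHom ≫ X.symLam ≫ X.symProj (1 : Fin 2) :=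
  AffineTangent.hom_ext (by simp) (by simp)

theorem incl_symLam_symProj :
    incl X.sym ≫ X.symLam ≫ X.symProj (0 : Fin 2) =
      incl X.sym ≫ X.symLam ≫ X.symProj (1 : Fin 2) :=
  sym_hom_ext (by simp) (by simp)

/-- The ring morphism `μ : T(Sym_R(M)) ⟶ Sym_R(M) ⊗_R Sym_R(M)`. -/
noncomputable def symMu : tangentAlgebraFunctor.obj X.sym ⟶ copow X.symInclHom 2 :=
  tangentAlgebraFunctor.map X.symAdd ≫
    copowMapPair X.symInclHom (X.symLam ≫ X.symProj 0) (zero X.sym ≫ X.symProj 1)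
      (AffineTangent.hom_ext (by simp) (by simp))

@[simp]
theorem symMu_incl_incl (a : X.ring) : X.symMu.hom ((incl _).hom (X.symIncl a)) =
    (copowProj X.symInclHom (0 : Fin 2)).hom (X.symIncl a) := by
  simp [symMu]

@[simp]
theorem symMu_incl_gen (m : X.mod) : X.symMu.hom ((incl _).hom (X.symGen m)) =
    (copowProj X.symInclHom (1 : Fin 2)).hom (X.symGen m) := by
  simp [symMu]

@[simp]
theorem symMu_d_incl (a : X.ring) : X.symMu.hom (d _ (X.symIncl a)) = 0 := by
  simp [symMu]

@[simp]
theorem symMu_d_gen (m : X.mod) : X.symMu.hom (d _ (X.symGen m)) =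
    (copowProj X.symInclHom (0 : Fin 2)).hom (X.symGen m) := by
  simp [symMu]

/-- A map `g` out of `T(Sym_R(M))` that kills every `d(a)` is linear over `R` in `d(m)`. Its values
on `a`, `m` and `d(m)` thus amount to two maps out of `Sym_R(M)` that agree on `R`, one reading `m`
and one reading `d(m)`. -/
theorem symMu_isPushout (j : Fin 2) :
    IsPushout (tangentAlgebraFunctor.map X.symInclHom) (zero X.ring) X.symMu
      (X.symInclHom ≫ X.symProj j) := by
  rw [comp_copowProj X.symInclHom j 0]
  have w : tangentAlgebraFunctor.map X.symInclHom ≫ X.symMu =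
      zero X.ring ≫ X.symInclHom ≫ X.symProj 0 :=
    AffineTangent.hom_ext (by simp) (by simp)
  have key {S : CommRingCat.{u}} (g : tangentAlgebraFunctor.obj X.sym ⟶ S) (f : X.ring ⟶ S)
      (h : tangentAlgebraFunctor.map X.symInclHom ≫ g = zero X.ring ≫ f) :
      ∃ k : copow X.symInclHom 2 ⟶ S,
        X.symMu ≫ k = g ∧ (X.symInclHom ≫ X.symProj 0) ≫ k = f := by
    have h₀ (a : X.ring) : g.hom ((incl _).hom (X.symIncl a)) = f.hom a := by
      simpa using congrArg (fun k => k.hom ((incl X.ring).hom a)) h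
    have h₁ (a : X.ring) : g.hom (d _ (X.symIncl a)) = 0 := by
      simpa using congrArg (fun k => k.hom (d X.ring a)) h
    -- As `μ` sends `d(m)` to the copy `0` and `m` to the copy `1`, the first factor must be `m ↦
    -- g(d(m))` and the second the restriction of `g`. By Leibniz, `h₁` removes the term with
    -- `d(a)`, which gives linearity of the first.
    refine ⟨copowPair X.symInclHom (symDesc f
      (g.hom.toAddMonoidHom.comp ((d X.sym).comp X.symGen))
      (fun a m => by simp [symGen_smul, AffineTangent.d_mul, h₀, h₁])) (incl _ ≫ g)
      (by ext a; simp [h₀]), ?_, ?_⟩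
    · exact tangent_sym_hom_ext (by simp [h₀]) (by simp) (by simp [h₁]) (by simp)
    · ext a
      simp
  have uniq {S : CommRingCat.{u}} {k l : copow X.symInclHom 2 ⟶ S}
      (h : X.symMu ≫ k = X.symMu ≫ l)
      (h' : (X.symInclHom ≫ X.symProj 0) ≫ k = (X.symInclHom ≫ X.symProj 0) ≫ l) : k = l := by
    have hi (a : X.ring) : k.hom ((X.symProj (0 : Fin 2)).hom (X.symIncl a)) =
        l.hom ((X.symProj (0 : Fin 2)).hom (X.symIncl a)) :=
      congrArg (fun m => m.hom a) h'
    -- The module generators of both copies lie in the image of `μ`, as `μ(d(m))` and `μ(m)`.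
    refine copow_hom_ext _ (sym_hom_ext hi fun m => ?_)
      (sym_hom_ext (fun a => by simpa using hi a) fun m => ?_)
    · simpa using congrArg (fun r => r.hom (d _ (X.symGen m))) h
    · simpa using congrArg (fun r => r.hom ((incl _).hom (X.symGen m))) h
  refine ⟨⟨w⟩, ⟨PushoutCocone.IsColimit.mk w (fun s => (key s.inl s.inr s.condition).choose)
    (fun s => (key s.inl s.inr s.condition).choose_spec.1)
    (fun s => (key s.inl s.inr s.condition).choose_spec.2) (fun s m hm hm' => ?_)⟩⟩
  exact uniq (hm.trans (key s.inl s.inr s.condition).choose_spec.1.symm)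
    (hm'.trans (key s.inl s.inr s.condition).choose_spec.2.symm)

/-- The differential bundle over `R` with total ring `Sym_R(M)`. -/
noncomputable def symBundle : AffineDifferentialBundle.{u} where
  base := op X.ring
  total := op X.sym
  q := X.symInclHom.op
  hasFibrePowers := inferInstance
  preservesFibrePowers :=
    inferInstanceAs (PreservesFibrePowers tangentAlgebraFunctor.{u}.op X.symInclHom.op)
  σ := X.symAdd.op
  z := X.symZero.op
  lam := X.symLam.op
  isAdditiveBundle := X.sym_isAdditiveBundle
  lam_map_proj := congrArg Quiver.Hom.op X.map_symInclHom_symLam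
  lam_map_add := by
    have h : tangentAlgebraFunctor.map X.symAdd ≫ copowMapPair X.symInclHom
        (X.symLam ≫ X.symProj 0) (X.symLam ≫ X.symProj 1) X.map_symInclHom_symLam_symProj =
        X.symLam ≫ X.symAdd :=
      tangent_sym_hom_ext (by simp) (by simp) (by simp) (by simp)
    exact congrArg Quiver.Hom.op h
  lam_map_zero := by
    have h : X.symLam ≫ X.symZero = tangentAlgebraFunctor.map X.symZero ≫ zero X.ring :=
      tangent_sym_hom_ext (by simp) (by simp) (by simp) (by simp)
    exact congrArg Quiver.Hom.op h
  lam_proj := congrArg Quiver.Hom.op X.incl_symLam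
  lam_add := by
    have h : add X.sym ≫ copair (X.symLam ≫ X.symProj 0) (X.symLam ≫ X.symProj 1)
        X.incl_symLam_symProj = X.symLam ≫ X.symAdd :=
      tangent_sym_hom_ext (by simp) (by simp) (by simp) (by simp)
    exact congrArg Quiver.Hom.op h
  lam_zero := by
    have h : X.symLam ≫ X.symZero = zero X.sym ≫ X.symZero :=
      tangent_sym_hom_ext (by simp) (by simp) (by simp) (by simp)
    exact congrArg Quiver.Hom.op h
  lam_lam := by
    have h : tangentAlgebraFunctor.map X.symLam ≫ X.symLam =
        AffineTangent.lift X.sym ≫ X.symLam :=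
      tangent_tangent_sym_hom_ext (by simp) (by simp) (by simp) (by simp) (by simp) (by simp)
        (by simp) (by simp)
    exact congrArg Quiver.Hom.op h
  lam_universal j n := by
    have h : IsPullback X.symMu.op (X.symInclHom ≫ X.symProj j).op
        (tangentAlgebraFunctor.map X.symInclHom).op (zero X.ring).op :=
      (X.symMu_isPushout j).op.flip
    -- On rings `T` is a left adjoint, so all its iterates preserve limits in the opposite category;
    -- the single pullback square suffices for every `n`.
    have : PreservesLimit (cospan (tangentAlgebraFunctor.map X.symInclHom).op (zero X.ring).op)
        (iterFunctor tangentAlgebraFunctor.{u}.op n) := iter_preserves _ n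
    exact h.map (iterFunctor tangentAlgebraFunctor.{u}.op n)

/-- The differential bundle with negatives over `R` with total ring `Sym_R(M)`. -/
noncomputable def symBundleWithNeg : AffineDifferentialBundleWithNeg.{u} where
  __ := X.symBundle
  neg := X.symNeg.op
  isNegation := X.sym_isNegation

end ModPair

end SymBundle

/-! ### Isomorphisms of differential bundles -/

section Isomorphisms

universe v u

variable {C : Type u} [Category.{v} C] {𝕋 : TangentStructure C}

/-- Isomorphisms of the total and the base objects that are compatible with the projections and
the lifts form an isomorphism of differential bundles. -/
def DifferentialBundle.isoMk {𝓔 𝓔' : DifferentialBundle 𝕋} (f : 𝓔.total ≅ 𝓔'.total)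
    (g : 𝓔.base ≅ 𝓔'.base) (hq : 𝓔.q ≫ g.hom = f.hom ≫ 𝓔'.q)
    (hlam : f.hom ≫ 𝓔'.lam = 𝓔.lam ≫ 𝕋.T.map f.hom) : 𝓔 ≅ 𝓔' where
  hom := ⟨f.hom, g.hom, hq, hlam⟩
  inv := ⟨f.inv, g.inv, by rw [Iso.comp_inv_eq, Category.assoc, Iso.eq_inv_comp, hq], by
    rw [Iso.inv_comp_eq, ← Category.assoc, hlam, Category.assoc, ← CategoryTheory.Functor.map_comp,
      f.hom_inv_id, CategoryTheory.Functor.map_id, Category.comp_id]⟩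
  hom_inv_id := DifferentialBundle.Hom.ext f.hom_inv_id g.hom_inv_id
  inv_hom_id := DifferentialBundle.Hom.ext f.inv_hom_id g.inv_hom_id

end Isomorphisms

/-! ### Functoriality and full faithfulness of `(R, M) ↦ Sym_R(M)` -/

section SymBundleFunctor

universe u

open AffineTangent fibrePow

namespace ModPair

/-- The functor `(R, M) ↦ Sym_R(M)` to differential bundles. -/
noncomputable def symBundleFunctor : ModPair.{u}ᵒᵖ ⥤ AffineDifferentialBundle.{u} where
  obj X := X.unop.symBundle
  map {X Y} F :=
    { f := (symMap F.unop).op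
      g := F.unop.g.op
      comm_q := by
        have h : F.unop.g ≫ X.unop.symInclHom = Y.unop.symInclHom ≫ symMap F.unop := by
          ext a
          simp [symMap_incl]
        exact congrArg Quiver.Hom.op h
      comm_lam := by
        have h : Y.unop.symLam ≫ symMap F.unop =
            tangentAlgebraFunctor.map (symMap F.unop) ≫ X.unop.symLam :=
          tangent_sym_hom_ext (by simp [symMap_incl]) (by simp [symMap_gen])
            (by simp [symMap_incl]) (by simp [symMap_gen])
        exact congrArg Quiver.Hom.op h }
  map_id X := DifferentialBundle.Hom.ext (congrArg Quiver.Hom.op (symFunctor.map_id X.unop)) rfl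
  map_comp F G := DifferentialBundle.Hom.ext
    (congrArg Quiver.Hom.op (symFunctor.map_comp G.unop F.unop)) rfl

/-- The functor `(R, M) ↦ Sym_R(M)` to differential bundles with negatives. -/
noncomputable def symBundleWithNegFunctor :
    ModPair.{u}ᵒᵖ ⥤ AffineDifferentialBundleWithNeg.{u} where
  obj X := X.unop.symBundleWithNeg
  map F := InducedCategory.Hom.mk (symBundleFunctor.map F)
  map_id X := InducedCategory.Hom.ext (symBundleFunctor.map_id X)
  map_comp F G := InducedCategory.Hom.ext (symBundleFunctor.map_comp F G)

/-- The map `x ↦ λ(d(x))` extracts the linear part of `x`. It kills scalars and fixes generators,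
and its Leibniz rule multiplies only by scalars `z(x)`, so its values never leave `M`. -/
theorem exists_symLam_d_eq (X : ModPair.{u}) (x : X.sym) :
    ∃ m, X.symLam.hom (d _ x) = X.symGen m := by
  have hincl (y : X.sym) :
      X.symLam.hom ((incl _).hom y) = X.symIncl (X.symZero.hom y) :=
    congrArg (fun k => k.hom y) X.incl_symLam
  have hmul (x y : X.sym) : (∃ m, X.symLam.hom (d _ x) = X.symGen m) →
      (∃ m, X.symLam.hom (d _ y) = X.symGen m) →
      ∃ m, X.symLam.hom (d _ (x * y)) = X.symGen m := by
    rintro ⟨m, hm⟩ ⟨n, hn⟩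
    refine ⟨X.symZero.hom x • n + X.symZero.hom y • m, ?_⟩
    rw [AffineTangent.d_mul, map_add, map_mul, map_mul, hm, hn, hincl, hincl, map_add,
      symGen_smul, symGen_smul]
  have hadd (x y : X.sym) : (∃ m, X.symLam.hom (d _ x) = X.symGen m) →
      (∃ m, X.symLam.hom (d _ y) = X.symGen m) →
      ∃ m, X.symLam.hom (d _ (x + y)) = X.symGen m := by
    rintro ⟨m, hm⟩ ⟨n, hn⟩
    exact ⟨m + n, by rw [map_add, map_add, map_add, hm, hn]⟩
  refine SymmetricAlgebra.induction (R := X.ring) (M := X.mod)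
    (motive := fun x => ∃ m, X.symLam.hom (d X.sym x) = X.symGen m) ?_ ?_ ?_ ?_ x
  · exact fun a => ⟨0, (X.symLam_d_incl a).trans (map_zero _).symm⟩
  · exact fun m => ⟨m, X.symLam_d_gen m⟩
  · exact fun x y hx hy => hmul x y hx hy
  · exact fun x y hx hy => hadd x y hx hy

instance : symBundleFunctor.{u}.Faithful where
  map_injective {X Y F G} h := by
    have hf : symMap F.unop = symMap G.unop :=
      congrArg Quiver.Hom.unop (congrArg DifferentialBundle.Hom.f h)
    have hg : F.unop.g = G.unop.g :=
      congrArg Quiver.Hom.unop (congrArg DifferentialBundle.Hom.g h)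
    refine Quiver.Hom.unop_inj (ModPair.Hom.ext hg (AddMonoidHom.ext fun m => ?_))
    apply X.unop.symGen_injective
    rw [← symMap_gen, ← symMap_gen, hf]

/-- A map compatible with the lifts commutes with `λ ∘ d`. Since `λ(d(m)) = m`, the image of a
generator is a value of `λ ∘ d`, hence again a generator. -/
theorem exists_symMap_eq {X Y : ModPair.{u}} (φ : X.sym ⟶ Y.sym) (g : X.ring ⟶ Y.ring)
    (hq : X.symInclHom ≫ φ = g ≫ Y.symInclHom)
    (hlam : X.symLam ≫ φ = tangentAlgebraFunctor.map φ ≫ Y.symLam) :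
    ∃ F : X ⟶ Y, F.g = g ∧ symMap F = φ := by
  have hi (a : X.ring) : φ.hom (X.symIncl a) = Y.symIncl (g.hom a) :=
    congrArg (fun k => k.hom a) hq
  have hm (m : X.mod) : ∃ n, Y.symGen n = φ.hom (X.symGen m) := by
    obtain ⟨n, hn⟩ := Y.exists_symLam_d_eq (φ.hom (X.symGen m))
    refine ⟨n, hn.symm.trans ?_⟩
    simpa using (congrArg (fun k => k.hom (d _ (X.symGen m))) hlam).symm
  choose f hf using hm
  let F : X ⟶ Y :=
    { g := g
      f :=
        { toFun := f
          -- The map `f` was only chosen elementwise; its laws hold because they hold for `φ` inside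
          -- the symmetric algebra, where the target module embeds.
          map_zero' := Y.symGen_injective (by simp [hf])
          map_add' := fun m n => Y.symGen_injective (by simp [hf]) }
      map_smul := fun a m => Y.symGen_injective (by simp [hf, symGen_smul, hi]) }
  exact ⟨F, rfl, sym_hom_ext (fun a => (symMap_incl F a).trans (hi a).symm)
    (fun m => (symMap_gen F m).trans (hf m))⟩

instance : symBundleFunctor.{u}.Full where
  map_surjective {X Y} H := by
    obtain ⟨F, hg, hf⟩ := exists_symMap_eq (X := Y.unop) (Y := X.unop) H.f.unop H.g.unop
      (congrArg Quiver.Hom.unop H.comm_q).symm (congrArg Quiver.Hom.unop H.comm_lam)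
    exact ⟨F.op, DifferentialBundle.Hom.ext (congrArg Quiver.Hom.op hf)
      (congrArg Quiver.Hom.op hg)⟩

end ModPair

/-! ### Every differential bundle is the symmetric algebra of its linear part -/

namespace AffineDifferentialBundle

variable (𝓔 : AffineDifferentialBundle.{u})

/-- The projection of a differential bundle, as a ring morphism. -/
noncomputable abbrev ringProj : 𝓔.base.unop ⟶ 𝓔.total.unop := 𝓔.q.unop

/-- The zero of a differential bundle, as a ring morphism. -/
noncomputable abbrev ringZero : 𝓔.total.unop ⟶ 𝓔.base.unop := 𝓔.z.unop

/-- The lift of a differential bundle, as a ring morphism. -/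
noncomputable def ringLift : tangentAlgebraFunctor.obj 𝓔.total.unop ⟶ 𝓔.total.unop := 𝓔.lam.unop

theorem ringZero_ringProj (a : 𝓔.base.unop) : 𝓔.ringZero.hom (𝓔.ringProj.hom a) = a :=
  congrArg (fun k => k.unop.hom a) 𝓔.isAdditiveBundle.zero_proj

theorem ringLift_incl (x : 𝓔.total.unop) :
    𝓔.ringLift.hom ((incl _).hom x) = 𝓔.ringProj.hom (𝓔.ringZero.hom x) :=
  congrArg (fun k => k.unop.hom x) 𝓔.lam_proj

/-- The derivation `x ↦ λ(d(x))`. -/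
noncomputable def deriv : 𝓔.total.unop →+ 𝓔.total.unop :=
  𝓔.ringLift.hom.toAddMonoidHom.comp (d _)

theorem ringLift_d (x : 𝓔.total.unop) : 𝓔.ringLift.hom (d _ x) = 𝓔.deriv x := rfl

theorem deriv_mul (x y : 𝓔.total.unop) :
    𝓔.deriv (x * y) = 𝓔.ringProj.hom (𝓔.ringZero.hom x) * 𝓔.deriv y +
      𝓔.ringProj.hom (𝓔.ringZero.hom y) * 𝓔.deriv x := by
  rw [← ringLift_d, AffineTangent.d_mul, map_add, map_mul, map_mul, ringLift_incl, ringLift_incl,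
    ringLift_d, ringLift_d]

theorem deriv_ringProj (a : 𝓔.base.unop) : 𝓔.deriv (𝓔.ringProj.hom a) = 0 := by
  have h : tangentAlgebraFunctor.map 𝓔.ringProj ≫ 𝓔.ringLift =
      zero 𝓔.base.unop ≫ 𝓔.ringProj := congrArg Quiver.Hom.unop 𝓔.lam_map_proj
  simpa [ringLift_d] using congrArg (fun k => k.hom (d _ a)) h

/-- Compatibility of the lift with the zero section, evaluated at `d(x)`, which the zero map kills.
-/
theorem ringZero_deriv (x : 𝓔.total.unop) : 𝓔.ringZero.hom (𝓔.deriv x) = 0 := by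
  have h : 𝓔.ringLift ≫ 𝓔.ringZero = zero 𝓔.total.unop ≫ 𝓔.ringZero :=
    congrArg Quiver.Hom.unop 𝓔.lam_zero
  simpa [ringLift_d] using congrArg (fun k => k.hom (d _ x)) h

/-- Evaluate `λ ∘ T(λ) = λ ∘ ℓ` at `d'd(x)`, which `ℓ` sends to `d(x)`. -/
theorem deriv_deriv (x : 𝓔.total.unop) : 𝓔.deriv (𝓔.deriv x) = 𝓔.deriv x := by
  have h : tangentAlgebraFunctor.map 𝓔.ringLift ≫ 𝓔.ringLift =
      AffineTangent.lift 𝓔.total.unop ≫ 𝓔.ringLift := congrArg Quiver.Hom.unop 𝓔.lam_lam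
  simpa [ringLift_d] using congrArg (fun k => k.hom (d _ (d _ x))) h

/-- The limit description of the total object, read in rings: a derivation `δ` along `g ∘ z` is a
ring map `T(E) → S` that restricts to `g ∘ z` on `E`, and vanishing of `δ` on the base is
compatibility with the zero of `T(A)`. -/
theorem existsUnique_desc {S : CommRingCat.{u}} (g : 𝓔.base.unop ⟶ S) (δ : 𝓔.total.unop →+ S)
    (hmul : ∀ x y, δ (x * y) = g.hom (𝓔.ringZero.hom x) * δ y + g.hom (𝓔.ringZero.hom y) * δ x)
    (hq : ∀ a, δ (𝓔.ringProj.hom a) = 0) :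
    ∃! k : 𝓔.total.unop ⟶ S,
      (∀ a, k.hom (𝓔.ringProj.hom a) = g.hom a) ∧ ∀ x, k.hom (𝓔.deriv x) = δ x := by
  have h₁ : incl _ ≫ desc (𝓔.ringZero ≫ g) δ hmul = 𝓔.ringZero ≫ g := by
    ext x
    simp
  have h₂ : tangentAlgebraFunctor.map 𝓔.ringProj ≫ desc (𝓔.ringZero ≫ g) δ hmul =
      zero 𝓔.base.unop ≫ g :=
    AffineTangent.hom_ext (by simp [ringZero_ringProj]) (by simp [hq])
  -- A map out of `T(E)` is determined on `x` and `d(x)`, and on `x` the lift is `q ∘ z`. Hence the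
  -- conditions on elements are equivalent to the two equations of `existsUnique_lift`.
  have key (k : 𝓔.total.unop ⟶ S) :
      ((∀ a, k.hom (𝓔.ringProj.hom a) = g.hom a) ∧ ∀ x, k.hom (𝓔.deriv x) = δ x) ↔
        k.op ≫ 𝓔.q = g.op ∧ k.op ≫ 𝓔.lam = (desc (𝓔.ringZero ≫ g) δ hmul).op := by
    constructor
    · rintro ⟨hk, hk'⟩
      have h₃ : 𝓔.ringProj ≫ k = g := by
        ext a
        exact hk a
      have h₄ : 𝓔.ringLift ≫ k = desc (𝓔.ringZero ≫ g) δ hmul :=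
        AffineTangent.hom_ext (by simp [ringLift_incl, hk]) (by simp [ringLift_d, hk'])
      exact ⟨congrArg Quiver.Hom.op h₃, congrArg Quiver.Hom.op h₄⟩
    · rintro ⟨hk, hk'⟩
      refine ⟨fun a => congrArg (fun k => k.unop.hom a) hk, fun x => ?_⟩
      exact (congrArg (fun k => k.unop.hom (d _ x)) hk').trans (desc_d _ _ _ x)
  obtain ⟨k, hk, hk'⟩ := 𝓔.existsUnique_lift (X := op S) (desc (𝓔.ringZero ≫ g) δ hmul).op g.op
    (congrArg Quiver.Hom.op h₁) (congrArg Quiver.Hom.op h₂)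
  exact ⟨k.unop, (key k.unop).2 hk, fun l hl => congrArg Quiver.Hom.unop (hk' l.op ((key l).1 hl))⟩

/-- The total ring, as an algebra over the base ring. -/
noncomputable abbrev algebra : Algebra 𝓔.base.unop 𝓔.total.unop := 𝓔.ringProj.hom.toAlgebra

/-- The fixed points of the derivation `x ↦ λ(d(x))`, as a module over the base ring. -/
noncomputable def linearPart : letI := 𝓔.algebra; Submodule 𝓔.base.unop 𝓔.total.unop :=
  letI := 𝓔.algebra
  { carrier := {x | 𝓔.deriv x = x}
    add_mem' := fun {x y} hx hy => (map_add _ _ _).trans (congrArg₂ _ hx hy)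
    zero_mem' := map_zero _
    smul_mem' := fun a x (hx : 𝓔.deriv x = x) => by
      change 𝓔.deriv (𝓔.ringProj.hom a * x) = 𝓔.ringProj.hom a * x
      rw [deriv_mul, ringZero_ringProj, deriv_ringProj, hx, mul_zero, add_zero] }

/-- The base ring together with the linear part of the total ring. -/
noncomputable def modPair : ModPair.{u} where
  ring := 𝓔.base.unop
  mod := letI := 𝓔.algebra; ModuleCat.of 𝓔.base.unop 𝓔.linearPart

/-- The inclusion of the linear part. -/
noncomputable def linearIncl : 𝓔.modPair.mod →+ 𝓔.total.unop :=
  letI := 𝓔.algebra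
  𝓔.linearPart.subtype.toAddMonoidHom

theorem linearIncl_smul (a : 𝓔.base.unop) (m : 𝓔.modPair.mod) :
    𝓔.linearIncl ((show 𝓔.modPair.ring from a) • m) = 𝓔.ringProj.hom a * 𝓔.linearIncl m := rfl

theorem linearIncl_injective : Function.Injective 𝓔.linearIncl := Subtype.val_injective

theorem deriv_linearIncl (m : 𝓔.modPair.mod) : 𝓔.deriv (𝓔.linearIncl m) = 𝓔.linearIncl m :=
  Subtype.property (p := fun x => 𝓔.deriv x = x) m

theorem ringZero_linearIncl (m : 𝓔.modPair.mod) : 𝓔.ringZero.hom (𝓔.linearIncl m) = 0 := by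
  rw [← deriv_linearIncl, ringZero_deriv]

/-- The derivation `x ↦ λ(d(x))`, as a map to the linear part. -/
noncomputable def linearDeriv : 𝓔.total.unop →+ 𝓔.modPair.mod where
  toFun x := ⟨𝓔.deriv x, 𝓔.deriv_deriv x⟩
  map_zero' := 𝓔.linearIncl_injective (map_zero 𝓔.deriv)
  map_add' x y := 𝓔.linearIncl_injective (map_add 𝓔.deriv x y)

theorem linearDeriv_linearIncl (m : 𝓔.modPair.mod) : 𝓔.linearDeriv (𝓔.linearIncl m) = m :=
  𝓔.linearIncl_injective (𝓔.deriv_linearIncl m)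

/-- The comparison morphism `Sym_A(M) ⟶ E` for the linear part `M` of `E`. -/
noncomputable def fromSym : 𝓔.modPair.sym ⟶ 𝓔.total.unop :=
  ModPair.symDesc (X := 𝓔.modPair) 𝓔.ringProj 𝓔.linearIncl 𝓔.linearIncl_smul

theorem fromSym_incl (a : 𝓔.modPair.ring) :
    𝓔.fromSym.hom (𝓔.modPair.symIncl a) = 𝓔.ringProj.hom a :=
  ModPair.symDesc_incl (X := 𝓔.modPair) _ _ _ a

theorem fromSym_gen (m : 𝓔.modPair.mod) :
    𝓔.fromSym.hom (𝓔.modPair.symGen m) = 𝓔.linearIncl m :=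
  ModPair.symDesc_gen (X := 𝓔.modPair) _ _ _ m

/-- The inverse comes from the universal property of `E`, applied to the derivation sending `x` to
its linear part viewed as a generator. -/
theorem isIso_fromSym : IsIso 𝓔.fromSym := by
  have hmul (x y : 𝓔.total.unop) : 𝓔.linearDeriv (x * y) =
      (show 𝓔.modPair.ring from 𝓔.ringZero.hom x) • 𝓔.linearDeriv y +
        (show 𝓔.modPair.ring from 𝓔.ringZero.hom y) • 𝓔.linearDeriv x :=
    𝓔.linearIncl_injective (𝓔.deriv_mul x y)
  have hq (a : 𝓔.base.unop) : 𝓔.linearDeriv (𝓔.ringProj.hom a) = 0 :=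
    𝓔.linearIncl_injective (𝓔.deriv_ringProj a)
  obtain ⟨k, ⟨hk, hk'⟩, -⟩ := 𝓔.existsUnique_desc 𝓔.modPair.symInclHom
    (𝓔.modPair.symGen.comp 𝓔.linearDeriv)
    (fun x y => by
      change 𝓔.modPair.symGen (𝓔.linearDeriv (x * y)) = _
      rw [hmul, map_add, ModPair.symGen_smul, ModPair.symGen_smul]
      rfl)
    (fun a => by
      change 𝓔.modPair.symGen (𝓔.linearDeriv _) = _
      rw [hq, map_zero])
  -- The universal property prescribes `k` on values of the derivation only; an element of the
  -- linear part is its own derivative.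
  have hk'' (m : 𝓔.modPair.mod) : k.hom (𝓔.linearIncl m) = 𝓔.modPair.symGen m := by
    rw [← 𝓔.deriv_linearIncl, hk']
    exact congrArg 𝓔.modPair.symGen (𝓔.linearDeriv_linearIncl m)
  refine ⟨k, ModPair.sym_hom_ext (fun a => ?_) (fun m => ?_), ?_⟩
  · exact (congrArg k.hom (𝓔.fromSym_incl a)).trans (hk a)
  · exact (congrArg k.hom (𝓔.fromSym_gen m)).trans (hk'' m)
  -- Both the identity of `E` and the round trip through `Sym_A(M)` correspond to the pair `(q, D)`.
  · refine (𝓔.existsUnique_desc 𝓔.ringProj 𝓔.deriv 𝓔.deriv_mul 𝓔.deriv_ringProj).unique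
      ⟨fun a => ?_, fun x => ?_⟩ ⟨fun _ => rfl, fun _ => rfl⟩
    · exact (congrArg 𝓔.fromSym.hom (hk a)).trans (𝓔.fromSym_incl a)
    · exact (congrArg 𝓔.fromSym.hom (hk' x)).trans (𝓔.fromSym_gen _)

theorem symLam_fromSym : 𝓔.modPair.symLam ≫ 𝓔.fromSym =
    tangentAlgebraFunctor.map 𝓔.fromSym ≫ 𝓔.ringLift := by
  -- The ring of `modPair` is the base ring only after unfolding, so the two facts are restated in
  -- the form in which `simp` meets them.
  have hz (a : 𝓔.modPair.ring) : 𝓔.ringZero.hom (𝓔.ringProj.hom a) = a := 𝓔.ringZero_ringProj a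
  have hd (a : 𝓔.modPair.ring) : 𝓔.deriv (𝓔.ringProj.hom a) = 0 := 𝓔.deriv_ringProj a
  refine ModPair.tangent_sym_hom_ext (fun a => ?_) (fun m => ?_) (fun a => ?_) (fun m => ?_)
  · simp [ringLift_incl, fromSym_incl, hz]
  · simp [ringLift_incl, fromSym_gen, ringZero_linearIncl]
  · simp [ringLift_d, fromSym_incl, hd]
  · simp [ringLift_d, fromSym_gen, deriv_linearIncl]

/-- A differential bundle is the symmetric algebra of its linear part. -/
noncomputable def isoSymBundle : 𝓔 ≅ 𝓔.modPair.symBundle :=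
  haveI := 𝓔.isIso_fromSym
  DifferentialBundle.isoMk (𝓔' := 𝓔.modPair.symBundle) (asIso 𝓔.fromSym).op (Iso.refl _)
    (by
      have h : 𝓔.ringProj = 𝓔.modPair.symInclHom ≫ 𝓔.fromSym := by
        ext a
        exact (𝓔.fromSym_incl a).symm
      exact (Category.comp_id _).trans (congrArg Quiver.Hom.op h))
    (congrArg Quiver.Hom.op 𝓔.symLam_fromSym)

end AffineDifferentialBundle

/-! ### The equivalence, without and with negatives -/

namespace ModPair

instance : symBundleFunctor.{u}.EssSurj where
  mem_essImage 𝓔 := ⟨op (AffineDifferentialBundle.modPair 𝓔),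
    ⟨(AffineDifferentialBundle.isoSymBundle 𝓔).symm⟩⟩

instance : symBundleFunctor.{u}.IsEquivalence where

instance : symBundleWithNegFunctor.{u}.IsEquivalence where
  faithful := by
    have : (symBundleWithNegFunctor.{u} ⋙ DifferentialBundleWithNeg.forgetNeg _).Faithful :=
      inferInstanceAs symBundleFunctor.{u}.Faithful
    exact .of_comp _ (DifferentialBundleWithNeg.forgetNeg _)
  full := by
    have : (symBundleWithNegFunctor.{u} ⋙ DifferentialBundleWithNeg.forgetNeg _).Full :=
      inferInstanceAs symBundleFunctor.{u}.Full
    exact .of_comp_faithful _ (DifferentialBundleWithNeg.forgetNeg _)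
  essSurj := ⟨fun 𝓔 => ⟨op (AffineDifferentialBundle.modPair 𝓔.toDifferentialBundle),
    -- Forgetting negatives is fully faithful, so the isomorphism of underlying bundles lifts
    -- without any check on the negatives.
    ⟨(DifferentialBundleWithNeg.forgetNeg _).preimageIso
      (AffineDifferentialBundle.isoSymBundle 𝓔.toDifferentialBundle).symm⟩⟩⟩

end ModPair

end SymBundleFunctor

universe u

theorem mainTheorem6 :
    ∃ e : ModPair.{u}ᵒᵖ ≌ AffineDifferentialBundleWithNeg.{u},
      (e.functor ⋙ DifferentialBundleWithNeg.forgetNeg _).IsEquivalence ∧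
      ∃ (β : e.functor ⋙ DifferentialBundleWithNeg.forgetNeg _ ⋙
            DifferentialBundle.baseFunctor _ ≅ ModPair.ringFunctor.{u}.op)
        (τ : e.functor ⋙ DifferentialBundleWithNeg.forgetNeg _ ⋙
            DifferentialBundle.totalFunctor _ ≅ ModPair.symFunctor.{u}.op),
        ∀ X : ModPair.{u}, IsSymBundle X (e.functor.obj (op X))
          (β.hom.app (op X)).unop (τ.hom.app (op X)).unop := by
  refine ⟨ModPair.symBundleWithNegFunctor.asEquivalence,
    -- Forgetting the negative gives back `symBundleFunctor` definitionally; likewise base and total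
    -- rings are literally `R` and `Sym_R(M)`, so both comparison isomorphisms have identity
    -- components.
    inferInstanceAs ModPair.symBundleFunctor.IsEquivalence,
    NatIso.ofComponents (fun X => Iso.refl (op X.unop.ring))
      (fun F => (Category.comp_id _).trans (Category.id_comp _).symm),
    NatIso.ofComponents (fun X => Iso.refl (op X.unop.sym))
      (fun F => (Category.comp_id _).trans (Category.id_comp _).symm), fun X => ?_⟩
  exact
    { q_incl := fun _ => rfl
      -- The sum is defined through the copy `0`; on scalars all coprojections agree.
      σ_incl := fun j a => (X.symAdd_incl a).trans (X.symProj_incl 0 j a)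
      σ_gen := X.symAdd_gen
      z_incl := X.symZero_incl
      z_gen := X.symZero_gen
      lam_incl := X.symLam_incl_incl
      lam_gen := X.symLam_incl_gen
      lam_d_incl := X.symLam_d_incl
      lam_d_gen := X.symLam_d_gen
      neg_incl := X.symNeg_incl
      neg_gen := X.symNeg_gen }
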